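/- Let $A$ be a non-normal complex $2\times 2$ matrix, and let $W(A)=\{\langle Ax,x\rangle : x\in\mathbb C^2,\ \|x\|=1\}$ be its numerical range. Then $W(A)$ is a non-degenerate closed elliptical disk whose foci are the eigenvalues of $A$: there are $c_1,c_2\in\mathbb C$ and $\ell\in\mathbb R$ such that the spectrum of $A$ is $\{c_1,c_2\}$, $|c_1-c_2|<\ell$ and $W(A)=\{z\in\mathbb C : |z-c_1|+|z-c_2|\le \ell\}$. Moreover, there exist a conformal map $a$ (a holomorphic bijection) from the interior of $W(A)$ onto the open unit disk $D=\{z\in\mathbb C : |z|<1\}$ and an invertible $2\times 2$ complex matrix $S$ such that $$\|S\|\,\|S^{-1}\|\le 2\qquad\text{and}\qquad \|S\,a(A)\,S^{-1}\|\le 1 .$$ Here $\|\cdot\|$ is the operator norm induced by the Euclidean norm of $\mathbb C^2$, and $a(A)$ is defined by the holomorphic functional calculus, i.e. $a(A)=p(A)$ for any polynomial $p$ that agrees with $a$ at the roots of the minimal polynomial of $A$, counted with multiplicity (so $p'=a'$ as well at a double root). -/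

import Mathlib

open scoped Matrix.Norms.L2Operator

/-- The numerical range `W(A) = {⟨A x, x⟩ : ‖x‖ = 1}` of a complex square matrix, with `x` ranging
over the unit sphere of Euclidean space. (Mathlib's inner product is linear in its second
argument.) -/
def numericalRange {n : Type*} [Fintype n] [DecidableEq n] (A : Matrix n n ℂ) : Set ℂ :=
  {w | ∃ x : EuclideanSpace ℂ n, ‖x‖ = 1 ∧ w = inner ℂ x (Matrix.toEuclideanCLM (𝕜 := ℂ) A x)}

/-- The closed elliptical disk with foci `c₁`, `c₂` and major axis of length `ℓ`;
it is non-degenerate exactly when `dist c₁ c₂ < ℓ`. -/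
def ellipticalDisk (c₁ c₂ : ℂ) (ℓ : ℝ) : Set ℂ :=
  {z | dist z c₁ + dist z c₂ ≤ ℓ}

/-- `f` maps the set `U` (an open set in the application) conformally, that is holomorphically and
bijectively, onto the set `V`. -/
def IsConformalMapOnto (f : ℂ → ℂ) (U V : Set ℂ) : Prop :=
  DifferentiableOn ℂ f U ∧ Set.BijOn f U V

/-- `p` interpolates `f` on the spectrum of `A` in the sense of Hermite: at each root `z` of the
minimal polynomial of `A`, the derivatives of `p` and `f` agree up to (not including) the order of
the multiplicity of `z`. -/
def InterpolatesOnSpectrum {n : Type*} [Fintype n] [DecidableEq n] (f : ℂ → ℂ)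
    (A : Matrix n n ℂ) (p : Polynomial ℂ) : Prop :=
  ∀ (z : ℂ) (k : ℕ), k < (minpoly ℂ A).rootMultiplicity z →
    (Polynomial.derivative^[k] p).eval z = iteratedDeriv k f z

theorem exists_interpolatesOnSpectrum {n : Type*} [Fintype n] [DecidableEq n] (f : ℂ → ℂ)
    (A : Matrix n n ℂ) : ∃ p : Polynomial ℂ, InterpolatesOnSpectrum f A p := by
  classical
  set m := minpoly ℂ A with hm
  have hm0 : m ≠ 0 := minpoly.ne_zero (Matrix.isIntegral A)
  let ι := {z : ℂ // z ∈ m.roots.toFinset}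
  -- the Taylor polynomial of `f` at a root
  let T : ι → Polynomial ℂ := fun z => Polynomial.taylor (-z.1)
    (∑ k ∈ Finset.range (m.rootMultiplicity z.1),
      Polynomial.C (iteratedDeriv k f z.1 / (k.factorial : ℂ)) * Polynomial.X ^ k)
  let I : ι → Ideal (Polynomial ℂ) := fun z =>
    Ideal.span {(Polynomial.X - Polynomial.C z.1) ^ m.rootMultiplicity z.1}
  have hI : Pairwise (Function.onFun IsCoprime I) := by
    intro z w hzw
    have hne : z.1 ≠ w.1 := fun h => hzw (Subtype.ext h)
    have h1 : IsCoprime (Polynomial.X - Polynomial.C z.1) (Polynomial.X - Polynomial.C w.1) :=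
      Polynomial.isCoprime_X_sub_C_of_isUnit_sub (sub_ne_zero.2 hne).isUnit
    exact (Ideal.isCoprime_span_singleton_iff _ _).2 (h1.pow)
  obtain ⟨p, hp⟩ := Ideal.exists_forall_sub_mem_ideal hI T
  refine ⟨p, fun z k hk => ?_⟩
  have hz : z ∈ m.roots.toFinset := by
    rw [Multiset.mem_toFinset, ← Multiset.count_pos, Polynomial.count_roots]
    exact lt_of_le_of_lt (Nat.zero_le _) hk
  obtain ⟨q, hq⟩ := Ideal.mem_span_singleton.1 (hp ⟨z, hz⟩)
  have hpe : p = T ⟨z, hz⟩ + (Polynomial.X - Polynomial.C z) ^ m.rootMultiplicity z * q := by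
    rw [← hq]; ring
  have h2 : (Polynomial.taylor z p).coeff k = iteratedDeriv k f z / (k.factorial : ℂ) := by
    have h3 : Polynomial.taylor z (T ⟨z, hz⟩) = ∑ k ∈ Finset.range (m.rootMultiplicity z),
        Polynomial.C (iteratedDeriv k f z / (k.factorial : ℂ)) * Polynomial.X ^ k := by
      simp only [T, Polynomial.taylor_taylor]
      simp
    have h4 : Polynomial.taylor z ((Polynomial.X - Polynomial.C z) ^ m.rootMultiplicity z * q)
        = Polynomial.X ^ m.rootMultiplicity z * Polynomial.taylor z q := by
      simp [Polynomial.taylor_mul, Polynomial.taylor_pow]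
    rw [hpe, map_add, h3, h4, Polynomial.coeff_add, Polynomial.coeff_X_pow_mul',
      if_neg (not_le.2 hk), add_zero, Polynomial.finsetSum_coeff]
    simp only [Polynomial.coeff_C_mul_X_pow]
    rw [Finset.sum_ite_eq, if_pos (Finset.mem_range.2 hk)]
  have hkf : (k.factorial : ℂ) ≠ 0 := Nat.cast_ne_zero.2 k.factorial_ne_zero
  rw [Polynomial.taylor_coeff, eq_div_iff hkf] at h2
  rw [← h2, ← Polynomial.factorial_smul_hasseDeriv]
  simp [mul_comm]

/-- The matrix function (holomorphic functional calculus) `f(A)`: the value at `A` of any polynomial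
that interpolates `f` on the spectrum of `A`. -/
noncomputable def matrixFunction {n : Type*} [Fintype n] [DecidableEq n] (f : ℂ → ℂ)
    (A : Matrix n n ℂ) : Matrix n n ℂ :=
  Polynomial.aeval A (exists_interpolatesOnSpectrum f A).choose

/-- `f(A)` does not depend on the choice of the interpolating polynomial. -/
theorem matrixFunction_eq_aeval {n : Type*} [Fintype n] [DecidableEq n] {f : ℂ → ℂ}
    {A : Matrix n n ℂ} {p : Polynomial ℂ} (hp : InterpolatesOnSpectrum f A p) :
    matrixFunction f A = Polynomial.aeval A p := by
  classical
  have hq := (exists_interpolatesOnSpectrum f A).choose_spec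
  unfold matrixFunction
  set q := (exists_interpolatesOnSpectrum f A).choose
  have hm0 : minpoly ℂ A ≠ 0 := minpoly.ne_zero (Matrix.isIntegral A)
  rw [← sub_eq_zero, ← map_sub]
  by_cases h0 : q - p = 0
  · rw [h0, map_zero]
  have hdvd : minpoly ℂ A ∣ q - p := by
    rw [Polynomial.Splits.dvd_iff_roots_le_roots (IsAlgClosed.splits _) hm0 h0,
      Multiset.le_iff_count]
    intro z
    rw [Polynomial.count_roots, Polynomial.count_roots]
    refine le_of_forall_lt fun k hk => ?_
    refine Polynomial.lt_rootMultiplicity_of_isRoot_iterate_derivative h0 fun j hj => ?_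
    rw [Polynomial.IsRoot, Polynomial.iterate_derivative_sub, Polynomial.eval_sub,
      hq z j (hj.trans_lt hk), hp z j (hj.trans_lt hk), sub_self]
  obtain ⟨r, hr⟩ := hdvd
  rw [hr, map_mul, minpoly.aeval, zero_mul]

/-! ### The series for the conformal map of an ellipse and its boundary values. -/

section Ellipse

open Complex Set Filter Topology
open Polynomial.Chebyshev (T T_complex_cos complex_ofReal_eval_T)

/-! Up to unitary equivalence and an affine change of variable, a non-normal `A` is antidiagonal
with entries `e^τ, e^{-τ}` (distinct eigenvalues) or `2, 0` (double eigenvalue). Its numerical range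
is then the ellipse `E` with foci `±1` and semi-axes `cosh τ, sinh τ`, or the unit disk.

For `E` the conformal map is the explicit `ellipseMap`, `a(z) = 2e^{-τ} z exp(∑ 2(-1)^n T_{2n}(z) /
(n(1+e^{4nτ})))`. At `cos(t - iτ)` the series combines with that of a logarithm to give `a =
e^{iθ(t)}` with `θ` real (`ellipseMap_boundary`), so `|a| ≤ 1` on `E`. This forces `θ' ≥ 0`; as `θ`
fixes the multiples of `π/2`, `e^{iθ}` lies in the same quadrant as the outward normal, so `Re a' ≥
0` on the boundary and `Re a' > 0` inside (`re_deriv_ellipseMap_pos`). Hence `a` is injective, and a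
connectedness argument makes it onto the disk.

Since `a` is odd, `a(A)` is, up to unitary equivalence, antidiagonal with entries `σe^τ, σe^{-τ}`,
where `σ = a(1)`. The bounds `σ ≤ 1` (maximum principle) and `σ ≤ 2e^{-τ}` (alternating series),
both in `ellipseMap_one`, are what is needed for a diagonal rescaling by a factor in `[1, 2]` to
give a contraction (`exists_similar_contraction`). -/

theorem norm_cos_le_cosh (x : ℂ) : ‖cos x‖ ≤ Real.cosh x.im := by
  have h : cos x = (exp (x * I) + exp (-x * I)) / 2 := rfl
  rw [h, Real.cosh_eq, norm_div, Complex.norm_ofNat]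
  gcongr
  refine (norm_add_le _ _).trans ?_
  rw [norm_exp, norm_exp]
  simp [add_comm]

/-- The distances of `cos(u + iv)` from `±1` are `cosh v ∓ cos u`. Thus cosine carries horizontal
lines to confocal ellipses, and membership in an elliptical disk becomes a bound on `|Im x|`. -/
theorem dist_cos_add_dist_cos (x : ℂ) :
    dist (cos x) 1 + dist (cos x) (-1) = 2 * Real.cosh x.im := by
  obtain ⟨u, v, rfl⟩ : ∃ u v : ℝ, x = u + v * I := ⟨x.re, x.im, (re_add_im x).symm⟩
  have hc := Real.cos_sq_add_sin_sq u
  have hh := Real.cosh_sq v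
  have h1 : 1 ≤ Real.cosh v := Real.one_le_cosh v
  have key (s : ℝ) (hs : s ^ 2 = 1) : dist (cos (u + v * I)) s = Real.cosh v - s * Real.cos u := by
    have h2 : cos (u + v * I) - s = (Real.cos u * Real.cosh v - s : ℝ)
        + (-(Real.sin u * Real.sinh v) : ℝ) * I := by
      rw [cos_add_mul_I]; push_cast; ring
    have h3 : 0 ≤ Real.cosh v - s * Real.cos u := by
      have : s * Real.cos u ≤ 1 := by
        refine (le_abs_self _).trans ?_
        rw [abs_mul, (pow_eq_one_iff_of_nonneg (abs_nonneg s) two_ne_zero).1 (by rw [sq_abs, hs]),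
          one_mul]
        exact Real.abs_cos_le_one u
      linarith
    rw [dist_eq, h2, norm_add_mul_I, ← Real.sqrt_sq h3]
    congr 1
    linear_combination (Real.sinh v ^ 2) * hc + (Real.cos u ^ 2 - 1) * hh + (1 - Real.cos u ^ 2) * hs
  have ha := key 1 (by norm_num)
  have hb := key (-1) (by norm_num)
  push_cast at ha hb
  rw [ha, hb]
  simp
  ring

/-- Every point of the plane is the cosine of a point of the closed lower half plane. -/
theorem exists_cos_eq_im_nonpos (z : ℂ) : ∃ x : ℂ, x.im ≤ 0 ∧ cos x = z := by
  obtain ⟨x, rfl⟩ := cos_surjective z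
  rcases le_total x.im 0 with h | h
  · exact ⟨x, h, rfl⟩
  · exact ⟨-x, by simpa using h, cos_neg x⟩

/-- The `n`-th term of the series for the logarithm of `a(z) / z`, up to an additive constant,
where `a` is the conformal map of the ellipse with foci `±1` and semi-axes `cosh τ`, `sinh τ`. -/
noncomputable def ellipseLogTerm (τ : ℝ) (n : ℕ) (z : ℂ) : ℂ :=
  (2 * (-1) ^ n / (n * (1 + Real.exp (4 * n * τ))) : ℝ) * (T ℂ (2 * n)).eval z

/-- The conformal map onto the unit disk of the interior of the ellipse with foci `±1` and
semi-axes `cosh τ`, `sinh τ`. -/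
noncomputable def ellipseMap (τ : ℝ) (z : ℂ) : ℂ :=
  (2 * Real.exp (-τ) : ℝ) * z * exp (∑' n, ellipseLogTerm τ n z)

theorem ellipseLogTerm_cos (τ : ℝ) (n : ℕ) (x : ℂ) : ellipseLogTerm τ n (cos x) =
    (2 * (-1) ^ n / (n * (1 + Real.exp (4 * n * τ))) : ℝ) * cos (2 * n * x) := by
  rw [ellipseLogTerm, T_complex_cos]
  simp

theorem ellipseLogTerm_neg (τ : ℝ) (n : ℕ) (z : ℂ) :
    ellipseLogTerm τ n (-z) = ellipseLogTerm τ n z := by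
  rw [ellipseLogTerm, Polynomial.Chebyshev.T_eval_neg]
  simp [ellipseLogTerm, Int.negOnePow_even]

theorem ellipseMap_neg (τ : ℝ) (z : ℂ) : ellipseMap τ (-z) = -ellipseMap τ z := by
  simp only [ellipseMap, ellipseLogTerm_neg]
  ring

/-- The open elliptical disk with foci `±1` on which the series defining `ellipseMap τ` is shown
to converge. -/
def bigEllipse (τ : ℝ) : Set ℂ := {z | dist z 1 + dist z (-1) < 2 * Real.cosh (3 / 2 * τ)}

theorem isOpen_bigEllipse (τ : ℝ) : IsOpen (bigEllipse τ) :=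
  isOpen_lt (by fun_prop) (by fun_prop)

theorem cos_mem_bigEllipse {τ : ℝ} (hτ : 0 < τ) {x : ℂ} :
    cos x ∈ bigEllipse τ ↔ |x.im| < 3 / 2 * τ := by
  rw [bigEllipse, mem_ofPred_eq, dist_cos_add_dist_cos, mul_lt_mul_iff_right₀ two_pos,
    Real.cosh_lt_cosh, abs_of_pos (by positivity : 0 < 3 / 2 * τ)]

theorem cos_mem_ellipticalDisk {τ : ℝ} (hτ : 0 < τ) {x : ℂ} :
    cos x ∈ ellipticalDisk 1 (-1) (2 * Real.cosh τ) ↔ |x.im| ≤ τ := by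
  rw [ellipticalDisk, mem_ofPred_eq, dist_cos_add_dist_cos, mul_le_mul_iff_right₀ two_pos,
    Real.cosh_le_cosh, abs_of_pos hτ]

theorem ellipticalDisk_subset_bigEllipse {τ : ℝ} (hτ : 0 < τ) :
    ellipticalDisk 1 (-1) (2 * Real.cosh τ) ⊆ bigEllipse τ := by
  intro z hz
  obtain ⟨x, rfl⟩ := cos_surjective z
  rw [cos_mem_bigEllipse hτ]
  rw [cos_mem_ellipticalDisk hτ] at hz
  linarith

/-- The coefficient decays like `e^{-4nτ}` while `cos(2nx)` is at most `e^{3nτ}` for `|Im x| <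
3τ/2`. Any factor strictly between 1 and 2 could replace `3/2`: the series must converge beyond the
closed ellipse. -/
theorem norm_ellipseLogTerm_le {τ : ℝ} (hτ : 0 < τ) (n : ℕ) {z : ℂ} (hz : z ∈ bigEllipse τ) :
    ‖ellipseLogTerm τ n z‖ ≤ 2 * Real.exp (-τ) ^ n := by
  obtain ⟨x, rfl⟩ := cos_surjective z
  rw [cos_mem_bigEllipse hτ] at hz
  rw [ellipseLogTerm_cos, norm_mul, norm_real]
  -- The term `n = 0` vanishes, because its coefficient is a division by zero.
  rcases n.eq_zero_or_pos with rfl | hn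
  · simp
  have hn1 : (1 : ℝ) ≤ n := by exact_mod_cast hn
  have h1 : ‖cos (2 * n * x)‖ ≤ Real.exp (3 * n * τ) := by
    refine (norm_cos_le_cosh _).trans ?_
    have h2 : (2 * n * x : ℂ).im = 2 * n * x.im := by
      have : (2 * n * x : ℂ) = ((2 * n : ℝ) : ℂ) * x := by push_cast; ring
      rw [this, im_ofReal_mul]
    rw [h2, ← Real.cosh_abs]
    have h3 : |2 * n * x.im| ≤ 3 * n * τ := by
      rw [abs_mul, abs_of_nonneg (by positivity)]
      nlinarith
    have h4 : 0 ≤ |2 * n * x.im| := abs_nonneg _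
    rw [Real.cosh_eq]
    have h5 : Real.exp (-|2 * n * x.im|) ≤ Real.exp (|2 * n * x.im|) := by gcongr; linarith
    have h6 : Real.exp (|2 * n * x.im|) ≤ Real.exp (3 * n * τ) := by gcongr
    linarith
  have h2 : ‖(2 * (-1) ^ n / (n * (1 + Real.exp (4 * n * τ))) : ℝ)‖
      ≤ 2 / Real.exp (4 * n * τ) := by
    rw [norm_div, norm_mul, norm_pow, norm_neg, norm_one, one_pow, mul_one, Real.norm_ofNat,
      Real.norm_of_nonneg (by positivity)]
    gcongr
    nlinarith [Real.exp_pos (4 * n * τ)]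
  calc _ ≤ 2 / Real.exp (4 * n * τ) * Real.exp (3 * n * τ) := by gcongr
    _ = 2 * Real.exp (-τ) ^ n := by
      rw [← Real.exp_nat_mul, div_mul_eq_mul_div, mul_div_assoc, ← Real.exp_sub]
      congr 2
      ring

theorem summable_two_mul_exp_neg_pow {τ : ℝ} (hτ : 0 < τ) :
    Summable fun n : ℕ => 2 * Real.exp (-τ) ^ n :=
  (summable_geometric_of_lt_one (Real.exp_pos _).le (Real.exp_lt_one_iff.2 (by linarith))).mul_left 2

theorem summable_ellipseLogTerm {τ : ℝ} (hτ : 0 < τ) {z : ℂ} (hz : z ∈ bigEllipse τ) :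
    Summable fun n => ellipseLogTerm τ n z :=
  .of_norm_bounded (summable_two_mul_exp_neg_pow hτ) fun n => norm_ellipseLogTerm_le hτ n hz

theorem differentiableOn_ellipseLog {τ : ℝ} (hτ : 0 < τ) :
    DifferentiableOn ℂ (fun z => ∑' n, ellipseLogTerm τ n z) (bigEllipse τ) := by
  refine differentiableOn_tsum_of_summable_norm (summable_two_mul_exp_neg_pow hτ) (fun n => ?_)
    (isOpen_bigEllipse τ) fun n z hz => norm_ellipseLogTerm_le hτ n hz
  exact ((Polynomial.differentiable _).const_mul _).differentiableOn

theorem differentiableOn_ellipseMap {τ : ℝ} (hτ : 0 < τ) :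
    DifferentiableOn ℂ (ellipseMap τ) (bigEllipse τ) :=
  (differentiableOn_id.const_mul _).mul (differentiableOn_ellipseLog hτ).cexp

/-- The logarithmic factor is real on the real axis. -/
theorem ellipseLog_ofReal (τ x : ℝ) : ∃ y : ℝ, ∑' n, ellipseLogTerm τ n x = y := by
  refine ⟨∑' n : ℕ, 2 * (-1) ^ n / (n * (1 + Real.exp (4 * n * τ))) * (T ℝ (2 * n)).eval x, ?_⟩
  rw [ofReal_tsum]
  congr 1 with n
  rw [ellipseLogTerm, ofReal_mul, complex_ofReal_eval_T]

/-- The argument of `ellipseMap τ` at the boundary point with eccentric angle `t`. -/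
noncomputable def boundaryArg (τ t : ℝ) : ℝ :=
  t + ∑' n : ℕ, (-1) ^ n * Real.sin (2 * n * t) / (n * Real.cosh (2 * n * τ))

/-- The added summand is the Taylor term of `log(1 + w)` at `w = e^{-2(τ+it)}`. The coefficient
`2/(1+e^{4nτ})` is the one for which the real parts cancel. -/
theorem ellipseLogTerm_boundary (τ : ℝ) (n : ℕ) (t : ℝ) :
    ellipseLogTerm τ n (cos (t - τ * I)) + (-1) ^ (n + 1) * exp (-2 * (τ + t * I)) ^ n / n =
      ((-1) ^ n * Real.sin (2 * n * t) / (n * Real.cosh (2 * n * τ)) : ℝ) * I := by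
  rcases n.eq_zero_or_pos with rfl | hn
  · simp [ellipseLogTerm]
  have hn0 : (n : ℂ) ≠ 0 := by exact_mod_cast hn.ne'
  rw [ellipseLogTerm_cos]
  push_cast
  have e1 : cos (2 * n * (t - τ * I)) = (exp (2 * n * t * I) * exp (2 * n * τ)
      + (exp (2 * n * t * I))⁻¹ * (exp (2 * n * τ))⁻¹) / 2 := by
    rw [← exp_neg, ← exp_neg, ← exp_add, ← exp_add, cos]
    congr 3
    · linear_combination (-2 * n * τ) * I_mul_I
    · linear_combination (2 * n * τ) * I_mul_I
  have e2 : exp (-2 * (τ + t * I)) ^ n = (exp (2 * n * t * I))⁻¹ * (exp (2 * n * τ))⁻¹ := by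
    rw [← exp_nat_mul, ← exp_neg, ← exp_neg, ← exp_add]
    congr 1; ring
  have e3 : sin (2 * n * t) = ((exp (2 * n * t * I))⁻¹ - exp (2 * n * t * I)) * I / 2 := by
    rw [← exp_neg, sin]; congr 4; ring
  have e4 : cosh (2 * n * τ) = (exp (2 * n * τ) + (exp (2 * n * τ))⁻¹) / 2 := by
    rw [← exp_neg, cosh]
  have e5 : exp (4 * n * τ) = exp (2 * n * τ) ^ 2 := by
    rw [← exp_nat_mul]; congr 1; push_cast; ring
  have hq : 1 + exp (2 * n * τ : ℂ) ^ 2 ≠ 0 := by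
    have : (1 + exp (2 * n * τ : ℂ) ^ 2) = ((1 + Real.exp (2 * n * τ) ^ 2 : ℝ) : ℂ) := by
      push_cast; rfl
    rw [this]
    exact_mod_cast (by positivity : 0 < 1 + Real.exp (2 * n * τ) ^ 2).ne'
  rw [e1, e2, e3, e4, e5, pow_succ]
  have hp0 := exp_ne_zero (2 * n * t * I)
  have hr0 := exp_ne_zero (2 * n * τ)
  generalize exp (2 * n * t * I) = p at *
  generalize exp (2 * n * τ : ℂ) = r at *
  have hq' : r ^ 2 + 1 ≠ 0 := by rwa [add_comm]
  field_simp
  rw [I_sq]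
  ring

/-- Here `2e^{-τ} cos(t - iτ) = e^{it}(1 + w)` with `|w| = e^{-2τ} < 1`, so the linear factor
supplies the logarithm that makes the total exponent purely imaginary. -/
theorem ellipseMap_boundary {τ : ℝ} (hτ : 0 < τ) (t : ℝ) :
    ellipseMap τ (cos (t - τ * I)) = exp (boundaryArg τ t * I) := by
  set w := exp (-2 * (τ + t * I)) with hw
  have hwn : ‖w‖ < 1 := by
    rw [hw, norm_exp, Real.exp_lt_one_iff]
    simpa using hτ
  have hmem : cos (t - τ * I) ∈ bigEllipse τ := by
    rw [cos_mem_bigEllipse hτ]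
    simp [abs_of_pos hτ]
    linarith
  have h1 := (summable_ellipseLogTerm hτ hmem).hasSum.add (hasSum_taylorSeries_log hwn)
  simp only [hw, ellipseLogTerm_boundary] at h1
  have h2 := h1.tsum_eq
  rw [tsum_mul_right, ← ofReal_tsum] at h2
  have h3 : (2 * Real.exp (-τ) : ℝ) * cos (t - τ * I) = exp (t * I) * (1 + w) := by
    rw [hw, cos]
    have e1 : (t - τ * I) * I = t * I + τ := by linear_combination (-τ : ℂ) * I_mul_I
    have e2 : -(t - τ * I) * I = -(t * I) + -τ := by linear_combination (τ : ℂ) * I_mul_I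
    have e3 : -2 * (τ + t * I) = -τ + -τ + (-(t * I) + -(t * I)) := by ring
    rw [e1, e2, e3]
    push_cast
    simp only [exp_add, exp_neg]
    have := exp_ne_zero (t * I)
    have := exp_ne_zero (τ : ℂ)
    field_simp
  have hw1 : 1 + w ≠ 0 := fun h => by
    rw [(neg_eq_of_add_eq_zero_right h).symm, norm_neg, norm_one] at hwn
    exact lt_irrefl _ hwn
  rw [ellipseMap, h3, boundaryArg]
  rw [← exp_log hw1, mul_assoc, ← exp_add, ← exp_add, add_comm (log _), ← h2]
  push_cast
  congr 1; ring

end Ellipse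

/-! ### The elliptical disk, its boundary and the maximum principle. -/

section EllipseMap

open Complex Set Filter Topology

theorem exists_cos_sub_mul_I_eq {τ : ℝ} (hτ : 0 < τ) {z : ℂ}
    (hz : dist z 1 + dist z (-1) = 2 * Real.cosh τ) : ∃ t : ℝ, cos (t - τ * I) = z := by
  obtain ⟨x, hx, rfl⟩ := exists_cos_eq_im_nonpos z
  rw [dist_cos_add_dist_cos, mul_right_inj' two_ne_zero] at hz
  have h := le_antisymm (Real.cosh_le_cosh.1 hz.le) (Real.cosh_le_cosh.1 hz.ge)
  rw [abs_of_pos hτ, abs_of_nonpos hx] at h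
  refine ⟨x.re, congrArg cos ?_⟩
  rw [← h, ofReal_neg, neg_mul, sub_neg_eq_add, re_add_im]

theorem norm_ellipseMap_boundary {τ : ℝ} (hτ : 0 < τ) {z : ℂ}
    (hz : dist z 1 + dist z (-1) = 2 * Real.cosh τ) : ‖ellipseMap τ z‖ = 1 := by
  obtain ⟨t, rfl⟩ := exists_cos_sub_mul_I_eq hτ hz
  rw [ellipseMap_boundary hτ, norm_exp_ofReal_mul_I]

theorem isClosed_ellipticalDisk (c₁ c₂ : ℂ) (ℓ : ℝ) : IsClosed (ellipticalDisk c₁ c₂ ℓ) :=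
  isClosed_le (by fun_prop) (by fun_prop)

theorem isBounded_ellipticalDisk (c₁ c₂ : ℂ) (ℓ : ℝ) :
    Bornology.IsBounded (ellipticalDisk c₁ c₂ ℓ) := by
  refine Metric.isBounded_closedBall.subset (t := Metric.closedBall c₁ ℓ) fun z hz => ?_
  have hz' : dist z c₁ + dist z c₂ ≤ ℓ := hz
  rw [Metric.mem_closedBall]
  linarith [dist_nonneg (x := z) (y := c₂)]

theorem convex_ellipticalDisk (c₁ c₂ : ℂ) (ℓ : ℝ) : Convex ℝ (ellipticalDisk c₁ c₂ ℓ) := by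
  have h := ((convexOn_univ_dist c₁).add (convexOn_univ_dist c₂)).convex_le ℓ
  simpa [ellipticalDisk] using h

theorem mem_interior_ellipticalDisk {c₁ c₂ z : ℂ} {ℓ : ℝ} (h : dist z c₁ + dist z c₂ < ℓ) :
    z ∈ interior (ellipticalDisk c₁ c₂ ℓ) := by
  refine mem_interior.2 ⟨{z | dist z c₁ + dist z c₂ < ℓ}, fun w hw => ?_,
    isOpen_lt (by fun_prop) (by fun_prop), h⟩
  have hw' : dist w c₁ + dist w c₂ < ℓ := hw
  exact hw'.le

theorem dist_add_dist_eq_of_notMem_interior {c₁ c₂ z : ℂ} {ℓ : ℝ}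
    (h : z ∈ ellipticalDisk c₁ c₂ ℓ) (h' : z ∉ interior (ellipticalDisk c₁ c₂ ℓ)) :
    dist z c₁ + dist z c₂ = ℓ := by
  by_contra hne
  exact h' (mem_interior_ellipticalDisk (lt_of_le_of_ne h hne))

theorem dist_add_dist_eq_of_mem_frontier_interior {c₁ c₂ z : ℂ} {ℓ : ℝ}
    (h : z ∈ frontier (interior (ellipticalDisk c₁ c₂ ℓ))) : dist z c₁ + dist z c₂ = ℓ := by
  have h2 := frontier_interior_subset h
  exact dist_add_dist_eq_of_notMem_interior
    ((isClosed_ellipticalDisk c₁ c₂ ℓ).frontier_subset h2) h2.2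

theorem zero_mem_interior_ellipticalDisk {τ : ℝ} (hτ : 0 < τ) :
    (0 : ℂ) ∈ interior (ellipticalDisk 1 (-1) (2 * Real.cosh τ)) := by
  refine mem_interior_ellipticalDisk ?_
  have := Real.one_lt_cosh.2 hτ.ne'
  simp
  linarith

theorem one_mem_interior_ellipticalDisk {τ : ℝ} (hτ : 0 < τ) :
    (1 : ℂ) ∈ interior (ellipticalDisk 1 (-1) (2 * Real.cosh τ)) := by
  refine mem_interior_ellipticalDisk ?_
  have := Real.one_lt_cosh.2 hτ.ne'
  rw [dist_self, dist_eq, show (1 - -1 : ℂ) = (2 : ℂ) by norm_num, Complex.norm_ofNat]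
  linarith

theorem closure_interior_subset_bigEllipse {τ : ℝ} (hτ : 0 < τ) :
    closure (interior (ellipticalDisk 1 (-1) (2 * Real.cosh τ))) ⊆ bigEllipse τ :=
  (closure_minimal interior_subset (isClosed_ellipticalDisk _ _ _)).trans
    (ellipticalDisk_subset_bigEllipse hτ)

theorem norm_ellipseMap_le_one {τ : ℝ} (hτ : 0 < τ) {z : ℂ}
    (hz : z ∈ ellipticalDisk 1 (-1) (2 * Real.cosh τ)) : ‖ellipseMap τ z‖ ≤ 1 := by
  by_cases hzi : z ∈ interior (ellipticalDisk 1 (-1) (2 * Real.cosh τ))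
  · refine norm_le_of_forall_mem_frontier_norm_le
      ((isBounded_ellipticalDisk _ _ _).subset interior_subset)
      ((differentiableOn_ellipseMap hτ).mono
        (closure_interior_subset_bigEllipse hτ)).diffContOnCl (fun w hw => ?_)
      (subset_closure hzi)
    exact (norm_ellipseMap_boundary hτ (dist_add_dist_eq_of_mem_frontier_interior hw)).le
  · exact (norm_ellipseMap_boundary hτ (dist_add_dist_eq_of_notMem_interior hz hzi)).le

/-! ### Monotonicity and symmetries of the boundary argument. -/

theorem differentiable_boundaryArg {τ : ℝ} (hτ : 0 < τ) : Differentiable ℝ (boundaryArg τ) := by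
  refine differentiable_id.add ?_
  have hs : Summable fun n : ℕ => 4 * Real.exp (-(2 * τ)) ^ n :=
    (summable_geometric_of_lt_one (Real.exp_pos _).le
      (Real.exp_lt_one_iff.2 (by linarith))).mul_left 4
  refine differentiable_tsum' hs
    (g' := fun n t => (-1) ^ n * (Real.cos (2 * n * t) * (2 * n)) / (n * Real.cosh (2 * n * τ)))
    (fun n t => ?_) (fun n t => ?_)
  · have h := ((hasDerivAt_id t).const_mul (2 * n : ℝ)).sin
    simp only [id_eq, mul_one] at h
    exact (h.const_mul _).div_const _
  · rcases n.eq_zero_or_pos with rfl | hn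
    · simp
    have hc : Real.exp (2 * n * τ) / 2 ≤ Real.cosh (2 * n * τ) := by
      rw [Real.cosh_eq]
      linarith [Real.exp_pos (-(2 * n * τ))]
    have hn' : (0 : ℝ) < n := by exact_mod_cast hn
    have hcp := Real.cosh_pos (2 * n * τ)
    rw [norm_div, norm_mul, norm_pow, norm_neg, norm_one, one_pow, one_mul, norm_mul,
      Real.norm_of_nonneg (by positivity : (0 : ℝ) ≤ 2 * n),
      Real.norm_of_nonneg (by positivity : (0 : ℝ) ≤ n * Real.cosh (2 * n * τ)), Real.norm_eq_abs]
    calc _ ≤ 1 * (2 * n) / (n * (Real.exp (2 * n * τ) / 2)) := by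
          gcongr
          exact Real.abs_cos_le_one _
      _ = 4 * Real.exp (-(2 * τ)) ^ n := by
          rw [← Real.exp_nat_mul, show (n : ℝ) * -(2 * τ) = -(2 * n * τ) by ring, Real.exp_neg]
          field_simp
          norm_num

theorem boundaryArg_zero (τ : ℝ) : boundaryArg τ 0 = 0 := by simp [boundaryArg]

theorem sin_two_mul_nat_mul_add_pi (n : ℕ) (t : ℝ) :
    Real.sin (2 * n * (t + Real.pi)) = Real.sin (2 * n * t) := by
  rw [show 2 * n * (t + Real.pi) = 2 * n * t + n * (2 * Real.pi) by ring,
    Real.sin_add_nat_mul_two_pi]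

theorem boundaryArg_add_pi (τ t : ℝ) :
    boundaryArg τ (t + Real.pi) = boundaryArg τ t + Real.pi := by
  simp only [boundaryArg, sin_two_mul_nat_mul_add_pi]
  ring

theorem boundaryArg_neg (τ t : ℝ) : boundaryArg τ (-t) = -boundaryArg τ t := by
  simp only [boundaryArg, mul_neg, Real.sin_neg, neg_div, tsum_neg]
  ring

/-- Oddness and the shift rule, compared at `-π/2`, leave no other value. -/
theorem boundaryArg_pi_div_two (τ : ℝ) : boundaryArg τ (Real.pi / 2) = Real.pi / 2 := by
  have h1 := boundaryArg_add_pi τ (-(Real.pi / 2))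
  rw [boundaryArg_neg, show -(Real.pi / 2) + Real.pi = Real.pi / 2 by ring] at h1
  linarith

theorem hasDerivAt_ellipseMap {τ : ℝ} (hτ : 0 < τ) {z : ℂ} (hz : z ∈ bigEllipse τ) :
    HasDerivAt (ellipseMap τ) (deriv (ellipseMap τ) z) z :=
  ((differentiableOn_ellipseMap hτ).differentiableAt
    ((isOpen_bigEllipse τ).mem_nhds hz)).hasDerivAt

theorem cos_sub_mul_I_mem_bigEllipse {τ : ℝ} (hτ : 0 < τ) (t : ℝ) :
    cos (t - τ * I) ∈ bigEllipse τ := by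
  rw [cos_mem_bigEllipse hτ]
  simp [abs_of_pos hτ]
  linarith

theorem deriv_ellipseMap_boundary {τ : ℝ} (hτ : 0 < τ) (t : ℝ) :
    deriv (ellipseMap τ) (cos (t - τ * I)) * -sin (t - τ * I) =
      exp (boundaryArg τ t * I) * (deriv (boundaryArg τ) t * I) := by
  have h1 : HasDerivAt (fun s : ℝ => ellipseMap τ (cos (s - τ * I)))
      (deriv (ellipseMap τ) (cos (t - τ * I)) * -sin (t - τ * I)) t := by
    have hF := (hasDerivAt_ellipseMap hτ (cos_sub_mul_I_mem_bigEllipse hτ t)).comp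
      (t - τ * I : ℂ) (hasDerivAt_cos _)
    have hg : HasDerivAt (fun s : ℝ => (s - τ * I : ℂ)) 1 t :=
      (hasDerivAt_id t).ofReal_comp.sub_const _
    have h := HasDerivAt.comp t hF hg
    rw [mul_one] at h
    exact h
  have h2 : HasDerivAt (fun s : ℝ => ellipseMap τ (cos (s - τ * I)))
      (exp (boundaryArg τ t * I) * (deriv (boundaryArg τ) t * I)) t := by
    simp only [ellipseMap_boundary hτ]
    exact ((differentiable_boundaryArg hτ t).hasDerivAt.ofReal_comp.mul_const I).cexp
  exact h1.unique h2

theorem HasDerivAt.nonneg_of_eventually_le_left {f : ℝ → ℝ} {f' x : ℝ} (hf : HasDerivAt f f' x)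
    (h : ∀ᶠ y in 𝓝[<] x, f y ≤ f x) : 0 ≤ f' := by
  have h1 := (hasDerivAt_iff_tendsto_slope.1 hf).mono_left
    (nhdsWithin_mono x (show Iio x ⊆ {x}ᶜ from fun y hy => hy.ne))
  refine ge_of_tendsto h1 ?_
  filter_upwards [h, self_mem_nhdsWithin] with y hy hyx
  rw [slope_def_field]
  exact div_nonneg_of_nonpos (by linarith) (by linarith [show y < x from hyx])

/-- Along the path `s ↦ cos(t - is)`, which reaches the boundary from inside at `s = τ`, the real
part of `e^{-iθ}a` is at most 1 and equals 1 at the end, so its derivative there is nonnegative.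
Since `a` is holomorphic, this normal derivative equals the tangential one, `θ'(t)`. -/
theorem deriv_boundaryArg_nonneg {τ : ℝ} (hτ : 0 < τ) (t : ℝ) : 0 ≤ deriv (boundaryArg τ) t := by
  have h1 : HasDerivAt (fun s : ℝ => ellipseMap τ (cos (t - s * I)))
      (exp (boundaryArg τ t * I) * (deriv (boundaryArg τ) t * I) * -I) τ := by
    have hF := (hasDerivAt_ellipseMap hτ (cos_sub_mul_I_mem_bigEllipse hτ t)).comp
      (t - τ * I : ℂ) (hasDerivAt_cos _)
    have hg : HasDerivAt (fun s : ℝ => (t - s * I : ℂ)) (-I) τ := by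
      simpa using ((hasDerivAt_id τ).ofReal_comp.mul_const I).const_sub (t : ℂ)
    rw [← deriv_ellipseMap_boundary hτ]
    exact HasDerivAt.comp τ hF hg
  set e := exp (boundaryArg τ t * I) with he
  have hen : ‖e‖ = 1 := norm_exp_ofReal_mul_I _
  have hee : e⁻¹ * e = 1 := inv_mul_cancel₀ (exp_ne_zero _)
  have h2 := (h1.const_mul e⁻¹)
  have h3 : HasDerivAt (fun s : ℝ => (e⁻¹ * ellipseMap τ (cos (t - s * I))).re)
      (e⁻¹ * (e * (deriv (boundaryArg τ) t * I) * -I)).re τ :=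
    reCLM.hasFDerivAt.comp_hasDerivAt τ h2
  have h4 : (e⁻¹ * (e * (deriv (boundaryArg τ) t * I) * -I)) =
      ((deriv (boundaryArg τ) t : ℝ) : ℂ) := by
    linear_combination (-((deriv (boundaryArg τ) t : ℝ) : ℂ) * I ^ 2) * hee
      - ((deriv (boundaryArg τ) t : ℝ) : ℂ) * I_sq
  rw [h4, ofReal_re] at h3
  refine h3.nonneg_of_eventually_le_left ?_
  rw [ellipseMap_boundary hτ, ← he, hee, one_re]
  filter_upwards [Ioo_mem_nhdsLT (show 0 < τ from hτ)] with s hs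
  refine (re_le_norm _).trans ?_
  rw [norm_mul, norm_inv, hen, inv_one, one_mul]
  refine norm_ellipseMap_le_one hτ ((cos_mem_ellipticalDisk hτ).2 ?_)
  simp [abs_of_pos hs.1, hs.2.le]

theorem monotone_boundaryArg {τ : ℝ} (hτ : 0 < τ) : Monotone (boundaryArg τ) :=
  monotone_of_deriv_nonneg (differentiable_boundaryArg hτ) (deriv_boundaryArg_nonneg hτ)

/-- By periodicity `t` may be taken in `[-π/2, π/2]`, an interval that the monotone `θ` maps to
itself because it fixes the endpoints. -/
theorem cos_boundaryArg_mul_cos_nonneg {τ : ℝ} (hτ : 0 < τ) (t : ℝ) :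
    0 ≤ Real.cos (boundaryArg τ t) * Real.cos t := by
  have hp : Function.Periodic (fun t => Real.cos (boundaryArg τ t) * Real.cos t) Real.pi := by
    intro t
    simp only [boundaryArg_add_pi, Real.cos_add_pi]
    ring
  obtain ⟨s, hs, h⟩ := hp.exists_mem_Ico Real.pi_pos t (-(Real.pi / 2))
  have h1 := monotone_boundaryArg hτ hs.1
  have h2 := monotone_boundaryArg hτ (show s ≤ Real.pi / 2 by linarith [hs.2])
  rw [boundaryArg_neg, boundaryArg_pi_div_two] at h1
  rw [boundaryArg_pi_div_two] at h2
  simp only [h]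
  exact mul_nonneg (Real.cos_nonneg_of_neg_pi_div_two_le_of_le h1 h2)
    (Real.cos_nonneg_of_neg_pi_div_two_le_of_le hs.1 (by linarith [hs.2]))

theorem sin_boundaryArg_mul_sin_nonneg {τ : ℝ} (hτ : 0 < τ) (t : ℝ) :
    0 ≤ Real.sin (boundaryArg τ t) * Real.sin t := by
  have hp : Function.Periodic (fun t => Real.sin (boundaryArg τ t) * Real.sin t) Real.pi := by
    intro t
    simp only [boundaryArg_add_pi, Real.sin_add_pi]
    ring
  obtain ⟨s, hs, h⟩ := hp.exists_mem_Ico Real.pi_pos t 0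
  have h1 := monotone_boundaryArg hτ hs.1
  have h2 := monotone_boundaryArg hτ hs.2.le
  rw [boundaryArg_zero] at h1
  rw [boundaryArg_add_pi, boundaryArg_zero] at h2
  simp only [h]
  exact mul_nonneg (Real.sin_nonneg_of_nonneg_of_le_pi h1 (by linarith))
    (Real.sin_nonneg_of_nonneg_of_le_pi hs.1 (by linarith [hs.2]))

/-! ### Positivity of the real part of the derivative, and injectivity. -/

theorem re_deriv_ellipseMap_boundary_nonneg {τ : ℝ} (hτ : 0 < τ) {z : ℂ}
    (hz : dist z 1 + dist z (-1) = 2 * Real.cosh τ) : 0 ≤ (deriv (ellipseMap τ) z).re := by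
  obtain ⟨t, rfl⟩ := exists_cos_sub_mul_I_eq hτ hz
  -- This is an outward normal to the ellipse at `cos(t - iτ)`. The derivative there is `θ' e^{iθ} /
  -- ν`, whose real part has the sign of `Re(e^{iθ} ν̄)`.
  set ν : ℂ := (Real.cos t * Real.sinh τ : ℝ) + (Real.sin t * Real.cosh τ : ℝ) * I with hν
  have hνs : I * sin (t - τ * I) = ν := by
    rw [sin_sub, cos_mul_I, sin_mul_I, hν]
    push_cast
    linear_combination (-cos t * sinh τ) * I_sq
  have hsinh := Real.sinh_pos_iff.2 hτ
  have hcosh := Real.cosh_pos τ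
  have hν0 : ν ≠ 0 := by
    intro h
    have h1 := congrArg Complex.re h
    have h2 := congrArg Complex.im h
    simp [hν, -ofReal_mul, -ofReal_cos, -ofReal_sin, hsinh.ne', hcosh.ne'] at h1 h2
    have := Real.cos_sq_add_sin_sq t
    simp [h1, h2] at this
  have h1 := deriv_ellipseMap_boundary hτ t
  set b := deriv (boundaryArg τ) t with hb
  have h2 : deriv (ellipseMap τ) (cos (t - τ * I)) = b * exp (boundaryArg τ t * I) / ν := by
    rw [eq_div_iff hν0, ← hνs]
    linear_combination (-I) * h1 - b * exp (boundaryArg τ t * I) * I_sq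
  have hb0 : 0 ≤ b := deriv_boundaryArg_nonneg hτ t
  rw [h2, mul_div_assoc, re_ofReal_mul, div_re, exp_ofReal_mul_I_re, exp_ofReal_mul_I_im,
    ← add_div]
  refine mul_nonneg hb0 (div_nonneg ?_ (normSq_nonneg _))
  have h3 : ν.re = Real.cos t * Real.sinh τ := by simp [hν, -ofReal_mul, -ofReal_cos, -ofReal_sin]
  have h4 : ν.im = Real.sin t * Real.cosh τ := by simp [hν, -ofReal_mul, -ofReal_cos, -ofReal_sin]
  rw [h3, h4, ← mul_assoc, ← mul_assoc]
  exact add_nonneg (mul_nonneg (cos_boundaryArg_mul_cos_nonneg hτ t) hsinh.le)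
    (mul_nonneg (sin_boundaryArg_mul_sin_nonneg hτ t) hcosh.le)

theorem deriv_ellipseMap_zero_re_pos {τ : ℝ} (hτ : 0 < τ) : 0 < (deriv (ellipseMap τ) 0).re := by
  have h0 : (0 : ℂ) ∈ bigEllipse τ :=
    ellipticalDisk_subset_bigEllipse hτ (interior_subset (zero_mem_interior_ellipticalDisk hτ))
  have hd := ((differentiableOn_ellipseLog hτ).differentiableAt
    ((isOpen_bigEllipse τ).mem_nhds h0)).hasDerivAt.cexp
  have h1 := ((hasDerivAt_id (0 : ℂ)).const_mul ((2 * Real.exp (-τ) : ℝ) : ℂ)).mul hd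
  obtain ⟨y, hy⟩ := ellipseLog_ofReal τ 0
  have h2 : HasDerivAt (ellipseMap τ) ((2 * Real.exp (-τ) * Real.exp y : ℝ) : ℂ) 0 := by
    convert! h1 using 1
    rw [← ofReal_zero, hy]
    simp
  rw [h2.deriv, ofReal_re]
  positivity

/-- The maximum principle for `exp(-a')` carries the boundary inequality inside. Equality at an
interior point would make its modulus constant, against `Re a'(0) > 0`. -/
theorem re_deriv_ellipseMap_pos {τ : ℝ} (hτ : 0 < τ) {z : ℂ}
    (hz : z ∈ interior (ellipticalDisk 1 (-1) (2 * Real.cosh τ))) :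
    0 < (deriv (ellipseMap τ) z).re := by
  set U := interior (ellipticalDisk 1 (-1) (2 * Real.cosh τ)) with hU
  have hd : DiffContOnCl ℂ (fun z => exp (-deriv (ellipseMap τ) z)) U :=
    (((differentiableOn_ellipseMap hτ).deriv (isOpen_bigEllipse τ)).neg.cexp.mono
      (closure_interior_subset_bigEllipse hτ)).diffContOnCl
  have hle : ∀ w ∈ U, ‖exp (-deriv (ellipseMap τ) w)‖ ≤ 1 := fun w hw => by
    refine norm_le_of_forall_mem_frontier_norm_le
      ((isBounded_ellipticalDisk _ _ _).subset interior_subset) hd (fun v hv => ?_)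
      (subset_closure hw)
    rw [norm_exp, Real.exp_le_one_iff, neg_re, neg_nonpos]
    exact re_deriv_ellipseMap_boundary_nonneg hτ (dist_add_dist_eq_of_mem_frontier_interior hv)
  by_contra hneg
  have hz1 : ‖exp (-deriv (ellipseMap τ) z)‖ = 1 := by
    refine le_antisymm (hle z hz) ?_
    rw [norm_exp, Real.one_le_exp_iff, neg_re]
    linarith
  have h2 := norm_eqOn_of_isPreconnected_of_isMaxOn
    ((convex_ellipticalDisk _ _ _).interior.isPreconnected) isOpen_interior hd.differentiableOn hz
    (fun w hw => by simpa [hz1] using hle w hw) (zero_mem_interior_ellipticalDisk hτ)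
  simp only [Function.comp, Function.const, hz1] at h2
  rw [norm_exp, Real.exp_eq_one_iff, neg_re] at h2
  linarith [deriv_ellipseMap_zero_re_pos hτ]

/-- A holomorphic function on an open convex set whose derivative has positive real part is
injective. -/
theorem injOn_of_re_deriv_pos {f : ℂ → ℂ} {U : Set ℂ} (hU : Convex ℝ U)
    (hf : ∀ z ∈ U, DifferentiableAt ℂ f z) (h : ∀ z ∈ U, 0 < (deriv f z).re) : InjOn f U := by
  intro z hz w hw hzw
  by_contra hne
  have hd : w - z ≠ 0 := sub_ne_zero.2 (Ne.symm hne)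
  have hseg : ∀ t ∈ Icc (0 : ℝ) 1, z + t * (w - z) ∈ U := fun t ht => by
    have := hU.add_smul_sub_mem hz hw ht
    simpa using this
  have hder : ∀ t ∈ Icc (0 : ℝ) 1, HasDerivAt (fun t : ℝ => ((w - z)⁻¹ * f (z + t * (w - z))).re)
      (deriv f (z + t * (w - z))).re t := fun t ht => by
    have hg : HasDerivAt (fun t : ℝ => (z + t * (w - z) : ℂ)) (w - z) t := by
      simpa using ((hasDerivAt_id t).ofReal_comp.mul_const (w - z)).const_add z
    have h1 := (HasDerivAt.comp t (hf _ (hseg t ht)).hasDerivAt hg).const_mul (w - z)⁻¹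
    have h2 := reCLM.hasFDerivAt.comp_hasDerivAt t h1
    convert! h2 using 1
    rw [reCLM_apply, mul_comm (deriv f _), inv_mul_cancel_left₀ hd]
  -- Along the segment, `Re((w-z)⁻¹ f)` has derivative `Re f' > 0`, so its values at the two ends
  -- cannot agree.
  have hmono : StrictMonoOn (fun t : ℝ => ((w - z)⁻¹ * f (z + t * (w - z))).re) (Icc 0 1) := by
    refine strictMonoOn_of_deriv_pos (convex_Icc 0 1)
      (fun t ht => (hder t ht).continuousAt.continuousWithinAt) fun t ht => ?_
    rw [interior_Icc] at ht
    rw [(hder t (Ioo_subset_Icc_self ht)).deriv]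
    exact h _ (hseg t (Ioo_subset_Icc_self ht))
  have := hmono (left_mem_Icc.2 zero_le_one) (right_mem_Icc.2 zero_le_one) zero_lt_one
  simp [hzw] at this

theorem injOn_ellipseMap {τ : ℝ} (hτ : 0 < τ) :
    InjOn (ellipseMap τ) (interior (ellipticalDisk 1 (-1) (2 * Real.cosh τ))) :=
  injOn_of_re_deriv_pos (convex_ellipticalDisk _ _ _).interior
    (fun _ hz => (hasDerivAt_ellipseMap hτ
      (ellipticalDisk_subset_bigEllipse hτ (interior_subset hz))).differentiableAt)
    fun _ hz => re_deriv_ellipseMap_pos hτ hz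

/-! ### Surjectivity onto the disk and the value at a focus. -/

theorem isOpen_image_ellipseMap {τ : ℝ} (hτ : 0 < τ) :
    IsOpen (ellipseMap τ '' interior (ellipticalDisk 1 (-1) (2 * Real.cosh τ))) := by
  set U := interior (ellipticalDisk 1 (-1) (2 * Real.cosh τ))
  have hU : U ⊆ bigEllipse τ := interior_subset.trans (ellipticalDisk_subset_bigEllipse hτ)
  have han : AnalyticOnNhd ℂ (ellipseMap τ) U :=
    ((differentiableOn_ellipseMap hτ).mono hU).analyticOnNhd isOpen_interior
  rcases han.is_constant_or_isOpen (convex_ellipticalDisk _ _ _).interior.isPreconnected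
    with ⟨w, hw⟩ | h
  · have h01 := injOn_ellipseMap hτ (zero_mem_interior_ellipticalDisk hτ)
      (one_mem_interior_ellipticalDisk hτ) (by
        rw [hw _ (zero_mem_interior_ellipticalDisk hτ), hw _ (one_mem_interior_ellipticalDisk hτ)])
    exact absurd h01 zero_ne_one
  · exact h U subset_rfl isOpen_interior

theorem isConformalMapOnto_ellipseMap {τ : ℝ} (hτ : 0 < τ) :
    IsConformalMapOnto (ellipseMap τ) (interior (ellipticalDisk 1 (-1) (2 * Real.cosh τ)))
      (Metric.ball 0 1) := by
  set U := interior (ellipticalDisk 1 (-1) (2 * Real.cosh τ)) with hUdef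
  have hU : U ⊆ bigEllipse τ := interior_subset.trans (ellipticalDisk_subset_bigEllipse hτ)
  have hopen := isOpen_image_ellipseMap hτ
  have hsub : ellipseMap τ '' U ⊆ Metric.ball 0 1 := by
    rw [← interior_closedBall _ one_ne_zero]
    refine interior_maximal ?_ hopen
    rintro _ ⟨z, hz, rfl⟩
    simpa using norm_ellipseMap_le_one hτ (interior_subset hz)
  refine ⟨(differentiableOn_ellipseMap hτ).mono hU, fun z hz => hsub ⟨z, hz, rfl⟩,
    injOn_ellipseMap hτ, ?_⟩
  have hK : IsCompact (ellipticalDisk 1 (-1) (2 * Real.cosh τ)) :=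
    Metric.isCompact_of_isClosed_isBounded (isClosed_ellipticalDisk _ _ _)
      (isBounded_ellipticalDisk _ _ _)
  have hcl : IsClosed (ellipseMap τ '' ellipticalDisk 1 (-1) (2 * Real.cosh τ)) :=
    (hK.image_of_continuousOn ((differentiableOn_ellipseMap hτ).continuousOn.mono
      (ellipticalDisk_subset_bigEllipse hτ))).isClosed
  -- The image is open, and it is relatively closed in the disk since the image of the compact
  -- ellipse is closed and boundary points go to the unit circle.
  refine (convex_ball (0 : ℂ) 1).isPreconnected.subset_of_closure_inter_subset hopen
    ⟨0, by simp, 0, zero_mem_interior_ellipticalDisk hτ, by simp [ellipseMap]⟩ ?_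
  rintro w ⟨hw, hwb⟩
  obtain ⟨z, hz, rfl⟩ := closure_minimal (image_mono interior_subset) hcl hw
  by_cases hzi : z ∈ U
  · exact ⟨z, hzi, rfl⟩
  · have := norm_ellipseMap_boundary hτ (dist_add_dist_eq_of_notMem_interior hz hzi)
    simp [this] at hwb

/-- Since `T_{2n}(1) = 1`, the logarithmic factor is minus an alternating series with decreasing
terms, hence nonpositive; this gives `σ ≤ 2e^{-τ}`. -/
theorem ellipseMap_one {τ : ℝ} (hτ : 0 < τ) :
    ∃ σ : ℝ, ellipseMap τ 1 = σ ∧ 0 < σ ∧ σ ≤ 1 ∧ σ ≤ 2 * Real.exp (-τ) := by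
  set c : ℕ → ℝ := fun n => 2 / ((n + 1 : ℕ) * (1 + Real.exp (4 * (n + 1 : ℕ) * τ))) with hc
  have h1mem : (1 : ℂ) ∈ bigEllipse τ :=
    ellipticalDisk_subset_bigEllipse hτ (interior_subset (one_mem_interior_ellipticalDisk hτ))
  have hs := (summable_ellipseLogTerm hτ h1mem).hasSum
  have hterm : ∀ n, ellipseLogTerm τ (n + 1) 1 = ((-((-1) ^ n * c n) : ℝ) : ℂ) := fun n => by
    rw [ellipseLogTerm, Polynomial.Chebyshev.T_eval_one, mul_one, hc, pow_succ]
    congr 1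
    ring
  have h0 : ellipseLogTerm τ 0 1 = 0 := by simp [ellipseLogTerm]
  obtain ⟨y, hy⟩ := ellipseLog_ofReal τ 1
  rw [ofReal_one] at hy
  rw [hy] at hs
  have hs' := (hasSum_nat_add_iff' 1).2 hs
  simp only [Finset.sum_range_one, h0, sub_zero, hterm] at hs'
  have hs2 : HasSum (fun n => (-1) ^ n * c n) (-y) := by
    have := (hasSum_ofReal.1 hs').neg
    simpa using this
  have hanti : Antitone c := fun m n hmn => by
    simp only [hc]
    have : ((m + 1 : ℕ) : ℝ) ≤ (n + 1 : ℕ) := by exact_mod_cast Nat.succ_le_succ hmn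
    gcongr
  -- The empty partial sum is already a lower bound, so `0 ≤ -y`.
  have hy0 := hanti.alternating_series_le_tendsto hs2.tendsto_sum_nat 0
  simp only [mul_zero, Finset.range_zero, Finset.sum_empty] at hy0
  have heq : ellipseMap τ 1 = ((2 * Real.exp (-τ) * Real.exp y : ℝ) : ℂ) := by
    rw [ellipseMap, hy]
    push_cast
    ring
  refine ⟨2 * Real.exp (-τ) * Real.exp y, heq, by positivity, ?_, ?_⟩
  · have := norm_ellipseMap_le_one hτ (interior_subset (one_mem_interior_ellipticalDisk hτ))
    rw [heq, norm_real] at this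
    exact (le_abs_self _).trans this
  · have : Real.exp y ≤ 1 := Real.exp_le_one_iff.2 (by linarith)
    exact mul_le_of_le_one_right (by positivity) this

end EllipseMap

/-! ### Unitary reduction to antidiagonal form. -/

section UnitaryEquivalence

open Matrix

/-- The matrix with zero diagonal and off-diagonal entries `r`, `s`. -/
def antidiagonal (r s : ℝ) : Matrix (Fin 2) (Fin 2) ℂ := !![0, (r : ℂ); (s : ℂ), 0]

theorem exists_eigenvector_of_det_eq_zero {M : Matrix (Fin 2) (Fin 2) ℂ} (h : M.det = 0) :
    ∃ u : Fin 2 → ℂ, star (u 0) * u 0 + star (u 1) * u 1 = 1 ∧ M *ᵥ u = 0 := by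
  obtain ⟨v, hv, hMv⟩ := exists_mulVec_eq_zero_iff.2 h
  have hpos : 0 < ‖v 0‖ ^ 2 + ‖v 1‖ ^ 2 := by
    by_contra hle
    refine hv (funext fun i => ?_)
    have h0 : ‖v 0‖ = 0 := by nlinarith [sq_nonneg ‖v 0‖, sq_nonneg ‖v 1‖]
    have h1 : ‖v 1‖ = 0 := by nlinarith [sq_nonneg ‖v 0‖, sq_nonneg ‖v 1‖]
    fin_cases i
    exacts [norm_eq_zero.1 h0, norm_eq_zero.1 h1]
  set N := Real.sqrt (‖v 0‖ ^ 2 + ‖v 1‖ ^ 2) with hN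
  have hNsq : (N : ℂ) ^ 2 = ‖v 0‖ ^ 2 + ‖v 1‖ ^ 2 := by exact_mod_cast Real.sq_sqrt hpos.le
  have hN0 : (N : ℂ) ≠ 0 := by exact_mod_cast (Real.sqrt_pos.2 hpos).ne'
  refine ⟨(N : ℂ)⁻¹ • v, ?_, by rw [mulVec_smul, hMv, smul_zero]⟩
  have e (x : ℂ) : star x * x = ‖x‖ ^ 2 := Complex.conj_mul' x
  have hs : star (N : ℂ)⁻¹ = (N : ℂ)⁻¹ := by simp
  simp only [Pi.smul_apply, smul_eq_mul, star_mul', hs]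
  field_simp
  rw [hNsq, e, e]

/-- Every complex number becomes a nonnegative real after multiplication by a suitable phase. -/
theorem exists_phase (z : ℂ) : ∃ w : ℂ, star w * w = 1 ∧ ∃ k : ℝ, 0 ≤ k ∧ z * w = k := by
  by_cases hz : z = 0
  · exact ⟨1, by simp, 0, le_rfl, by simp [hz]⟩
  · have hn : (‖z‖ : ℂ) ≠ 0 := by simpa using hz
    refine ⟨star z / ‖z‖, ?_, ‖z‖, norm_nonneg z, ?_⟩
    · have h1 : z * star z = ‖z‖ ^ 2 := Complex.mul_conj' z
      simp only [star_div₀, star_star]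
      rw [Complex.star_def, Complex.conj_ofReal]
      field_simp
      exact h1
    · have h1 : z * star z = ‖z‖ ^ 2 := Complex.mul_conj' z
      field_simp
      exact h1

/-- As `⟨u, v⟩` is real, `u + v` and `u - v` are orthogonal, and `B/d` swaps them. Normalizing them
by their lengths `p` and `q` gives an orthonormal basis in which `B/d` has off-diagonal entries
`p/q` and `q/p`. -/
theorem exists_unitary_of_eigenvectors {B : Matrix (Fin 2) (Fin 2) ℂ} {u v : Fin 2 → ℂ} {d : ℂ}
    (hd : d ≠ 0) {k : ℝ} (hk : 0 ≤ k)
    (hu : star (u 0) * u 0 + star (u 1) * u 1 = 1) (hv : star (v 0) * v 0 + star (v 1) * v 1 = 1)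
    (huv : star (u 0) * v 0 + star (u 1) * v 1 = k)
    (hBu : B *ᵥ u = d • u) (hBv : B *ᵥ v = -d • v) :
    ∃ U ∈ unitary (Matrix (Fin 2) (Fin 2) ℂ), ∃ r : ℝ, 1 ≤ r ∧
      B = U * (d • antidiagonal r r⁻¹) * star U := by
  have hvu : star (v 0) * u 0 + star (v 1) * u 1 = k := by
    have := congrArg star huv
    simpa [mul_comm] using this
  have hpsum : ‖u 0 - v 0‖ ^ 2 + ‖u 1 - v 1‖ ^ 2 = 2 - 2 * k := by
    have e (x : ℂ) : ((‖x‖ : ℝ) : ℂ) ^ 2 = star x * x := (Complex.conj_mul' x).symm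
    have : ((‖u 0 - v 0‖ ^ 2 + ‖u 1 - v 1‖ ^ 2 : ℝ) : ℂ) = ((2 - 2 * k : ℝ) : ℂ) := by
      push_cast
      rw [e, e, star_sub, star_sub]
      linear_combination hu + hv - huv - hvu
    exact_mod_cast this
  -- Otherwise `u = v` would be an eigenvector for both `d` and `-d`.
  have hk1 : k < 1 := by
    by_contra hge
    have h0 : u 0 = v 0 := by
      rw [← sub_eq_zero, ← norm_eq_zero]
      nlinarith [sq_nonneg ‖u 0 - v 0‖, sq_nonneg ‖u 1 - v 1‖]
    have h1 : u 1 = v 1 := by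
      rw [← sub_eq_zero, ← norm_eq_zero]
      nlinarith [sq_nonneg ‖u 0 - v 0‖, sq_nonneg ‖u 1 - v 1‖]
    have huv' : u = v := by ext i; fin_cases i <;> assumption
    rw [huv', hBv] at hBu
    have h2 : (2 * d) • v = 0 := by
      have : (2 * d) • v = d • v - -d • v := by module
      rw [this, hBu, sub_self]
    rw [smul_eq_zero_iff_right (mul_ne_zero two_ne_zero hd)] at h2
    simp [h2] at hv
  set p := Real.sqrt (2 + 2 * k) with hp
  set q := Real.sqrt (2 - 2 * k) with hq
  have hp0 : 0 < p := Real.sqrt_pos.2 (by linarith)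
  have hq0 : 0 < q := Real.sqrt_pos.2 (by linarith)
  have hpc : (p : ℂ) ≠ 0 := by exact_mod_cast hp0.ne'
  have hqc : (q : ℂ) ≠ 0 := by exact_mod_cast hq0.ne'
  have hp2 : (p : ℂ) ^ 2 = 2 + 2 * k := by exact_mod_cast Real.sq_sqrt (by linarith)
  have hq2 : (q : ℂ) ^ 2 = 2 - 2 * k := by exact_mod_cast Real.sq_sqrt (by linarith)
  have sp : star (p : ℂ) = p := Complex.conj_ofReal p
  have sq : star (q : ℂ) = q := Complex.conj_ofReal q
  set U : Matrix (Fin 2) (Fin 2) ℂ :=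
    !![(u 0 + v 0) / p, (u 0 - v 0) / q; (u 1 + v 1) / p, (u 1 - v 1) / q] with hUdef
  have hUU : star U * U = 1 := by
    ext i j
    fin_cases i <;> fin_cases j <;>
      simp only [hUdef, star_eq_conjTranspose, mul_apply, Fin.sum_univ_two, conjTranspose_apply,
        one_apply, of_apply, cons_val', cons_val_zero, cons_val_one, cons_val_fin_one, star_div₀,
        sp, sq, star_add, star_sub, Fin.zero_eta, Fin.mk_one, Fin.isValue, if_true, if_false,
        zero_ne_one, one_ne_zero, empty_val'] <;> field_simp
    · rw [hp2]; linear_combination hu + hv + huv + hvu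
    · linear_combination hu - hv - huv + hvu
    · linear_combination hu - hv + huv - hvu
    · rw [hq2]; linear_combination hu + hv - huv - hvu
  have hUm : U ∈ unitary (Matrix (Fin 2) (Fin 2) ℂ) :=
    Unitary.mem_iff.2 ⟨hUU, mul_eq_one_comm.1 hUU⟩
  refine ⟨U, hUm, p / q, (one_le_div hq0).2 (Real.sqrt_le_sqrt (by linarith)), ?_⟩
  have hBU : B * U = U * (d • antidiagonal (p / q) (p / q)⁻¹) := by
    have a0 := congrFun hBu 0
    have a1 := congrFun hBu 1
    have b0 := congrFun hBv 0
    have b1 := congrFun hBv 1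
    simp only [mulVec, dotProduct, Fin.sum_univ_two, Pi.smul_apply, smul_eq_mul] at a0 a1 b0 b1
    ext i j
    fin_cases i <;> fin_cases j <;>
      simp [hUdef, mul_apply, antidiagonal] <;> field_simp
    · linear_combination a0 + b0
    · linear_combination a0 - b0
    · linear_combination a1 + b1
    · linear_combination a1 - b1
  rw [← hBU, mul_assoc, mul_eq_one_comm.1 hUU, mul_one]

/-- In an orthonormal basis starting with a kernel vector, only the upper right entry survives. The
normalization `2` makes the numerical range of the model the unit disk. -/
theorem exists_unitary_of_nilpotent {B : Matrix (Fin 2) (Fin 2) ℂ} (htr : B.trace = 0)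
    (hdet : B.det = 0) : ∃ U ∈ unitary (Matrix (Fin 2) (Fin 2) ℂ), ∃ d : ℂ,
      B = U * (d • antidiagonal 2 0) * star U := by
  obtain ⟨u, hu, hBu⟩ := exists_eigenvector_of_det_eq_zero hdet
  set U : Matrix (Fin 2) (Fin 2) ℂ := !![u 0, -star (u 1); u 1, star (u 0)] with hUdef
  have hUU : star U * U = 1 := by
    ext i j
    fin_cases i <;> fin_cases j <;>
      simp [hUdef, star_eq_conjTranspose, mul_apply, -Complex.star_def]
    · exact hu
    · ring
    · ring
    · rw [Complex.star_def] at hu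
      linear_combination hu
  have hUU' := mul_eq_one_comm.1 hUU
  refine ⟨U, Unitary.mem_iff.2 ⟨hUU, hUU'⟩, (star U * B * U) 0 1 / 2, ?_⟩
  have a0 := congrFun hBu 0
  have a1 := congrFun hBu 1
  simp only [mulVec, dotProduct, Fin.sum_univ_two, Pi.zero_apply] at a0 a1
  have hcol (i : Fin 2) : (star U * B * U) i 0 = 0 := by
    rw [mul_assoc, mul_apply, Fin.sum_univ_two]
    have h0 : (B * U) 0 0 = 0 := by simpa [mul_apply, hUdef] using a0
    have h1 : (B * U) 1 0 = 0 := by simpa [mul_apply, hUdef] using a1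
    rw [h0, h1, mul_zero, mul_zero, add_zero]
  have htr' : (star U * B * U) 1 1 = 0 := by
    have h : (star U * B * U).trace = 0 := by
      rw [trace_mul_comm, ← mul_assoc, hUU', one_mul, htr]
    rwa [trace_fin_two, hcol, zero_add] at h
  have hM : star U * B * U = ((star U * B * U) 0 1 / 2) • antidiagonal 2 0 := by
    ext i j
    fin_cases i <;> fin_cases j
    · simpa [antidiagonal] using hcol 0
    · simp [antidiagonal]
    · simpa [antidiagonal] using hcol 1
    · simpa [antidiagonal] using htr'
  rw [← hM, ← mul_assoc, ← mul_assoc, hUU', one_mul, mul_assoc, hUU', mul_one]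

theorem isStarNormal_unitary_conj {U M : Matrix (Fin 2) (Fin 2) ℂ}
    (hU : U ∈ unitary (Matrix (Fin 2) (Fin 2) ℂ)) (h : IsStarNormal M) :
    IsStarNormal (U * M * star U) := by
  refine ⟨?_⟩
  have hUU := (Unitary.mem_iff.1 hU).1
  have hc : star M * M = M * star M := h.1
  have e (X Y : Matrix (Fin 2) (Fin 2) ℂ) :
      (U * X * star U) * (U * Y * star U) = U * (X * Y) * star U := by
    calc _ = U * X * (star U * U) * Y * star U := by simp only [mul_assoc]
      _ = _ := by rw [hUU]; simp only [mul_assoc, mul_one]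
  have hs : star (U * M * star U) = U * star M * star U := by
    rw [star_mul, star_mul, star_star, mul_assoc]
  rw [commute_iff_eq, hs, e, e, hc]

/-- A non-normal `2 × 2` matrix is unitarily equivalent to an affine function of a matrix with zero
diagonal whose off-diagonal entries are `exp τ, exp (-τ)` or `2, 0`. -/
theorem exists_unitary_antidiagonal {A : Matrix (Fin 2) (Fin 2) ℂ} (hA : ¬ IsStarNormal A) :
    ∃ U ∈ unitary (Matrix (Fin 2) (Fin 2) ℂ), ∃ μ d : ℂ, d ≠ 0 ∧ ∃ r s : ℝ,
      A = U * (μ • 1 + d • antidiagonal r s) * star U ∧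
      ((∃ τ : ℝ, 0 < τ ∧ r = Real.exp τ ∧ s = Real.exp (-τ)) ∨ (r = 2 ∧ s = 0)) := by
  set μ := A.trace / 2 with hμ
  set B := A - μ • 1 with hB
  have htr : B.trace = 0 := by
    simp [hB, trace_fin_two, hμ]
  have hconj {U M : Matrix (Fin 2) (Fin 2) ℂ} (hU : U ∈ unitary (Matrix (Fin 2) (Fin 2) ℂ))
      (h : B = U * M * star U) : A = U * (μ • 1 + M) * star U := by
    rw [mul_add, add_mul, ← h, mul_smul_comm, mul_one, smul_mul_assoc, (Unitary.mem_iff.1 hU).2,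
      hB]
    abel
  obtain ⟨d, hd'⟩ := IsAlgClosed.exists_pow_nat_eq (-B.det) two_pos
  have hd := hd'.symm
  by_cases hd0 : d = 0
  · have hdet : B.det = 0 := by
      rw [hd0] at hd
      simpa using hd
    obtain ⟨U, hU, d', h⟩ := exists_unitary_of_nilpotent htr hdet
    refine ⟨U, hU, μ, d', ?_, 2, 0, hconj hU h, .inr ⟨rfl, rfl⟩⟩
    rintro rfl
    refine hA ?_
    rw [hconj hU h]
    refine isStarNormal_unitary_conj hU ⟨?_⟩
    simp only [zero_smul, add_zero, commute_iff_eq, star_smul, star_one, smul_mul_smul_comm,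
      mul_comm]
  · rw [det_fin_two] at hd
    rw [trace_fin_two] at htr
    have hdet (x : ℂ) (hx : x ^ 2 = d ^ 2) : (B - x • (1 : Matrix (Fin 2) (Fin 2) ℂ)).det = 0 := by
      simp [det_fin_two]
      linear_combination -hd + hx - x * htr
    obtain ⟨u, hu, hBu⟩ := exists_eigenvector_of_det_eq_zero (hdet d rfl)
    obtain ⟨v, hv, hBv⟩ := exists_eigenvector_of_det_eq_zero (hdet (-d) (by ring))
    rw [sub_mulVec, smul_mulVec, one_mulVec, sub_eq_zero] at hBu hBv
    -- A change of phase of `v` makes the inner product of the eigenvectors real and nonnegative.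
    obtain ⟨w, hw, k, hk, hwk⟩ := exists_phase (star (u 0) * v 0 + star (u 1) * v 1)
    obtain ⟨U, hU, r, hr, h⟩ := exists_unitary_of_eigenvectors (v := w • v) hd0 hk hu
      (by
        simp only [Pi.smul_apply, smul_eq_mul, star_mul']
        linear_combination hw + star w * w * hv) (by
        rw [← hwk]
        simp only [Pi.smul_apply, smul_eq_mul]
        ring) hBu (by rw [mulVec_smul, hBv, smul_comm])
    refine ⟨U, hU, μ, d, hd0, r, r⁻¹, hconj hU h, .inl ⟨Real.log r, ?_, ?_, ?_⟩⟩
    -- For `r = 1` the antidiagonal matrix is Hermitian, which would make `A` normal.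
    · refine Real.log_pos (lt_of_le_of_ne hr fun h1 => hA ?_)
      rw [hconj hU h, ← h1]
      refine isStarNormal_unitary_conj hU ⟨?_⟩
      have hs : star (antidiagonal 1 1⁻¹) = antidiagonal 1 1⁻¹ := by
        ext i j
        fin_cases i <;> fin_cases j <;> simp [antidiagonal]
      rw [commute_iff_eq, star_add, star_smul, star_smul, hs, star_one]
      simp only [add_mul, mul_add, smul_mul_assoc, mul_smul_comm, one_mul, mul_one]
      module
    · rw [Real.exp_log (by linarith)]
    · rw [Real.exp_neg, Real.exp_log (by linarith)]

end UnitaryEquivalence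

/-! ### Numerical ranges of the model matrices and affine changes of variable. -/

section NumericalRange

open Matrix

theorem numericalRange_unitary_conj {n : Type*} [Fintype n] [DecidableEq n] {U : Matrix n n ℂ}
    (hU : U ∈ unitary (Matrix n n ℂ)) (M : Matrix n n ℂ) :
    numericalRange (U * M * star U) = numericalRange M := by
  have key {V : Matrix n n ℂ} (hV : V ∈ unitary (Matrix n n ℂ)) (M : Matrix n n ℂ) :
      numericalRange (V * M * star V) ⊆ numericalRange M := by
    rintro _ ⟨x, hx, rfl⟩
    have hadj (y z : EuclideanSpace ℂ n) : inner ℂ y (toEuclideanCLM (𝕜 := ℂ) V z) =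
        inner ℂ (toEuclideanCLM (𝕜 := ℂ) (star V) y) z := by
      rw [map_star, ContinuousLinearMap.star_eq_adjoint, ContinuousLinearMap.adjoint_inner_left]
    refine ⟨toEuclideanCLM (𝕜 := ℂ) (star V) x, ?_, ?_⟩
    · rw [← hx, @norm_eq_sqrt_re_inner ℂ, @norm_eq_sqrt_re_inner ℂ _ _ _ _ x, ← hadj,
        ← mul_apply_eq_comp, ← map_mul, (Unitary.mem_iff.1 hV).2, map_one,
        one_apply_eq_self]
    · rw [map_mul, map_mul, mul_apply_eq_comp, mul_apply_eq_comp, hadj]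
  refine (key hU M).antisymm ?_
  have h := key (Unitary.star_mem hU) (U * M * star U)
  have e : star U * (U * M * star U) * star (star U) = M := by
    rw [star_star]
    calc _ = (star U * U) * M * (star U * U) := by simp only [mul_assoc]
      _ = M := by rw [(Unitary.mem_iff.1 hU).1, one_mul, mul_one]
  rwa [e] at h

theorem numericalRange_add_smul {n : Type*} [Fintype n] [DecidableEq n] (μ d : ℂ)
    (M : Matrix n n ℂ) :
    numericalRange (μ • 1 + d • M) = (fun z => μ + d * z) '' numericalRange M := by
  have key (x : EuclideanSpace ℂ n) (hx : ‖x‖ = 1) :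
      inner ℂ x (toEuclideanCLM (𝕜 := ℂ) (μ • 1 + d • M) x) =
        μ + d * inner ℂ x (toEuclideanCLM (𝕜 := ℂ) M x) := by
    rw [map_add, map_smul, map_smul, map_one]
    simp [inner_self_eq_norm_sq_to_K, hx]
  ext w
  constructor
  · rintro ⟨x, hx, rfl⟩
    exact ⟨_, ⟨x, hx, rfl⟩, (key x hx).symm⟩
  · rintro ⟨_, ⟨x, hx, rfl⟩, rfl⟩
    exact ⟨x, hx, (key x hx).symm⟩

/-- The quadratic form depends only on `w = x̄₀x₁`, which fills the disk of radius `1/2` as `x` runs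
over the unit sphere. -/
theorem numericalRange_antidiagonal (r s : ℝ) : numericalRange (antidiagonal r s) =
    (fun w : ℂ => r * w + s * star w) '' Metric.closedBall (0 : ℂ) (1 / 2) := by
  have hin (x : EuclideanSpace ℂ (Fin 2)) :
      inner ℂ x (toEuclideanCLM (𝕜 := ℂ) (antidiagonal r s) x) =
        r * (star (x 0) * x 1) + s * star (star (x 0) * x 1) := by
    rw [PiLp.inner_apply, Fin.sum_univ_two, ofLp_toEuclideanCLM]
    simp [antidiagonal, mulVec, dotProduct, Fin.sum_univ_two]
    ring
  ext z
  constructor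
  · rintro ⟨x, hx, rfl⟩
    refine ⟨star (x 0) * x 1, ?_, (hin x).symm⟩
    have hx2 : ‖x 0‖ ^ 2 + ‖x 1‖ ^ 2 = 1 := by
      rw [← Fin.sum_univ_two (fun i => ‖x i‖ ^ 2), ← EuclideanSpace.norm_sq_eq, hx, one_pow]
    rw [mem_closedBall_zero_iff, norm_mul, norm_star]
    nlinarith [sq_nonneg (‖x 0‖ - ‖x 1‖)]
  · rintro ⟨w, hw, rfl⟩
    rw [mem_closedBall_zero_iff] at hw
    -- Chosen so that `cos α · sin α = ‖w‖`.
    set α := Real.arcsin (2 * ‖w‖) / 2 with hα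
    have hsin : Real.cos α * Real.sin α = ‖w‖ := by
      have h1 : Real.sin (2 * α) = 2 * ‖w‖ := by
        rw [hα, mul_div_cancel₀ _ two_ne_zero,
          Real.sin_arcsin (by linarith [norm_nonneg w]) (by linarith)]
      rw [Real.sin_two_mul] at h1
      linarith
    set x : EuclideanSpace ℂ (Fin 2) :=
      WithLp.toLp 2 ![(Real.cos α : ℂ), Real.sin α * Complex.exp (w.arg * Complex.I)] with hx
    have hw' : star (x 0) * x 1 = w := by
      simp only [hx, cons_val_zero, cons_val_one, Complex.star_def, Complex.conj_ofReal]
      rw [← mul_assoc, ← Complex.ofReal_mul, hsin, Complex.norm_mul_exp_arg_mul_I]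
    refine ⟨x, ?_, ?_⟩
    · rw [← sq_eq_sq₀ (norm_nonneg _) zero_le_one, EuclideanSpace.norm_sq_eq, Fin.sum_univ_two]
      simp only [hx, cons_val_zero, cons_val_one, norm_mul, Complex.norm_exp_ofReal_mul_I,
        Complex.norm_real, Real.norm_eq_abs, sq_abs, mul_one, one_pow]
      exact Real.cos_sq_add_sin_sq α
    · rw [hin, hw']

/-- The map `w ↦ e^τ w + e^{-τ} w̄` stretches the two axes by `2 cosh τ` and `2 sinh τ`, giving the
Cartesian equation of the ellipse; it is matched with the focal one through `z = cos x`. -/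
theorem numericalRange_antidiagonal_exp {τ : ℝ} (hτ : 0 < τ) :
    numericalRange (antidiagonal (Real.exp τ) (Real.exp (-τ))) =
      ellipticalDisk 1 (-1) (2 * Real.cosh τ) := by
  have hs := Real.sinh_pos_iff.2 hτ
  have hc := Real.cosh_pos τ
  have h1 : numericalRange (antidiagonal (Real.exp τ) (Real.exp (-τ))) =
      {z | (z.re / Real.cosh τ) ^ 2 + (z.im / Real.sinh τ) ^ 2 ≤ 1} := by
    rw [numericalRange_antidiagonal]
    have hn (w : ℂ) : ‖w‖ ≤ 1 / 2 ↔ (2 * w.re) ^ 2 + (2 * w.im) ^ 2 ≤ 1 := by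
      rw [← abs_of_nonneg (norm_nonneg w), ← abs_of_pos (one_half_pos (α := ℝ)), ← sq_le_sq,
        Complex.sq_norm, Complex.normSq_apply]
      constructor <;> intro h <;> nlinarith
    have he := Real.cosh_add_sinh τ
    have he' := Real.cosh_sub_sinh τ
    ext z
    constructor
    · rintro ⟨w, hw, rfl⟩
      rw [mem_closedBall_zero_iff, hn] at hw
      have hre : (Real.exp τ * w + Real.exp (-τ) * star w : ℂ).re = Real.cosh τ * (2 * w.re) := by
        rw [Complex.add_re, Complex.re_ofReal_mul, Complex.re_ofReal_mul, Complex.star_def,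
          Complex.conj_re]
        linear_combination (-w.re) * (he + he')
      have him : (Real.exp τ * w + Real.exp (-τ) * star w : ℂ).im = Real.sinh τ * (2 * w.im) := by
        rw [Complex.add_im, Complex.im_ofReal_mul, Complex.im_ofReal_mul, Complex.star_def,
          Complex.conj_im]
        linear_combination (-w.im) * (he - he')
      rw [Set.mem_ofPred_eq, hre, him, mul_div_cancel_left₀ _ hc.ne',
        mul_div_cancel_left₀ _ hs.ne']
      exact hw
    · intro hz
      refine ⟨⟨z.re / Real.cosh τ / 2, z.im / Real.sinh τ / 2⟩, ?_, ?_⟩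
      · rw [mem_closedBall_zero_iff, hn]
        simp only [mul_div_cancel₀ _ (two_ne_zero (α := ℝ))]
        exact hz
      · apply Complex.ext
        · simp only [Complex.add_re, Complex.re_ofReal_mul, Complex.star_def, Complex.conj_re]
          rw [← he, ← he']
          field_simp
          ring
        · simp only [Complex.add_im, Complex.im_ofReal_mul, Complex.star_def, Complex.conj_im]
          rw [← he, ← he']
          field_simp
          ring
  rw [h1]
  ext z
  obtain ⟨x, rfl⟩ := Complex.cos_surjective z
  rw [cos_mem_ellipticalDisk hτ, Set.mem_ofPred_eq]
  obtain ⟨u, v, rfl⟩ : ∃ u v : ℝ, x = u + v * Complex.I :=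
    ⟨x.re, x.im, (Complex.re_add_im x).symm⟩
  have key : Complex.cos (u + v * Complex.I) = (Real.cos u * Real.cosh v : ℝ) +
      (-(Real.sin u * Real.sinh v) : ℝ) * Complex.I := by
    rw [Complex.cos_add_mul_I]; push_cast; ring
  have hre : (Complex.cos (u + v * Complex.I)).re = Real.cos u * Real.cosh v := by
    rw [key]; simp [-Complex.ofReal_mul, -Complex.ofReal_cos, -Complex.ofReal_sin]
  have him : (Complex.cos (u + v * Complex.I)).im = -(Real.sin u * Real.sinh v) := by
    rw [key]; simp [-Complex.ofReal_mul, -Complex.ofReal_cos, -Complex.ofReal_sin]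
  have hv : (u + v * Complex.I : ℂ).im = v := by simp
  rw [hre, him, hv, div_pow, div_pow, mul_pow, neg_sq, mul_pow, div_add_div _ _ (by positivity)
    (by positivity), div_le_one (by positivity), Real.cosh_sq, Real.cosh_sq]
  have hcs := Real.cos_sq_add_sin_sq u
  have hab : |v| ≤ τ ↔ Real.sinh v ^ 2 ≤ Real.sinh τ ^ 2 := by
    rw [sq_le_sq, Real.abs_sinh, abs_of_pos hs, Real.sinh_le_sinh]
  rw [hab]
  have hT : 0 < Real.sinh τ ^ 2 := by positivity
  generalize Real.sinh v ^ 2 = V at *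
  generalize Real.sinh τ ^ 2 = T at *
  have hc2 := sq_nonneg (Real.cos u)
  have hs2 := sq_nonneg (Real.sin u)
  generalize Real.cos u ^ 2 = a at *
  generalize Real.sin u ^ 2 = b at *
  obtain rfl : a = 1 - b := by linarith
  -- The defect in the Cartesian inequality factors, and `T + b > 0`, so its sign is that of `V -
  -- T`.
  have hfac : (1 - b) * (V + 1) * T + (T + 1) * (b * V) - (T + 1) * T = (V - T) * (T + b) := by
    ring
  constructor
  · intro h
    have : (V - T) * (T + b) ≤ 0 := by linarith
    by_contra hlt
    have := mul_pos (sub_pos.2 (not_le.1 hlt)) (by linarith : 0 < T + b)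
    linarith
  · intro h
    have := mul_nonneg (sub_nonneg.2 h) (by linarith : 0 ≤ T + b)
    nlinarith

theorem numericalRange_antidiagonal_two_zero :
    numericalRange (antidiagonal 2 0) = ellipticalDisk 0 0 2 := by
  rw [numericalRange_antidiagonal]
  ext z
  simp only [ellipticalDisk, Set.mem_ofPred_eq, dist_zero_right, Set.mem_image,
    mem_closedBall_zero_iff, Complex.ofReal_zero, zero_mul, add_zero, Complex.ofReal_ofNat]
  constructor
  · rintro ⟨w, hw, rfl⟩
    rw [norm_mul, Complex.norm_ofNat]
    linarith
  · intro h
    refine ⟨z / 2, ?_, by ring⟩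
    rw [norm_div, Complex.norm_ofNat]
    linarith

theorem image_ellipticalDisk {μ d : ℂ} (hd : d ≠ 0) (c₁ c₂ : ℂ) (ℓ : ℝ) :
    (fun z => μ + d * z) '' ellipticalDisk c₁ c₂ ℓ =
      ellipticalDisk (μ + d * c₁) (μ + d * c₂) (‖d‖ * ℓ) := by
  have hdist (z w : ℂ) : dist (μ + d * z) (μ + d * w) = ‖d‖ * dist z w := by
    rw [dist_add_left, dist_eq_norm, ← mul_sub, norm_mul, dist_eq_norm]
  ext z
  obtain ⟨w, rfl⟩ : ∃ w, μ + d * w = z := ⟨(z - μ) / d, by field_simp; ring⟩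
  have hinj : Function.Injective fun z => μ + d * z := fun a b h => by
    simpa [hd] using h
  rw [hinj.mem_set_image (f := fun z => μ + d * z)]
  simp only [ellipticalDisk, Set.mem_ofPred_eq, hdist, ← mul_add]
  exact (mul_le_mul_iff_right₀ (norm_pos_iff.2 hd)).symm

theorem interior_image_affine {μ d : ℂ} (hd : d ≠ 0) (E : Set ℂ) :
    interior ((fun z => μ + d * z) '' E) = (fun z => μ + d * z) '' interior E :=
  (((Homeomorph.mulLeft₀ d hd).trans (Homeomorph.addLeft μ)).image_interior E).symm

theorem IsConformalMapOnto.comp_affine {g : ℂ → ℂ} {U V : Set ℂ} (h : IsConformalMapOnto g U V)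
    {μ d : ℂ} (hd : d ≠ 0) :
    IsConformalMapOnto (fun z => g ((z - μ) / d)) ((fun z => μ + d * z) '' U) V := by
  have hinv (z : ℂ) : (μ + d * z - μ) / d = z := by
    rw [add_sub_cancel_left, mul_div_cancel_left₀ _ hd]
  have hmaps : Set.MapsTo (fun z => (z - μ) / d) ((fun z => μ + d * z) '' U) U := by
    rintro _ ⟨z, hz, rfl⟩
    simpa only [hinv] using hz
  refine ⟨h.1.comp (by fun_prop) hmaps, h.2.comp ⟨hmaps, ?_, ?_⟩⟩
  · rintro _ ⟨z, -, rfl⟩ _ ⟨w, -, rfl⟩ hzw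
    simp only [hinv] at hzw
    rw [hzw]
  · exact fun z hz => ⟨μ + d * z, ⟨z, hz, rfl⟩, hinv z⟩

end NumericalRange

/-! ### Functions of the matrix and the diagonal rescaling. -/

section MatrixFunction

open Matrix Polynomial

theorem antidiagonal_mul_self (r s : ℝ) :
    antidiagonal r s * antidiagonal r s = ((r * s : ℝ) : ℂ) • 1 := by
  ext i j
  fin_cases i <;> fin_cases j <;> simp [antidiagonal, mul_comm]

theorem sub_smul_one_eq_unitary_conj {U M : Matrix (Fin 2) (Fin 2) ℂ}
    (hU : U ∈ unitary (Matrix (Fin 2) (Fin 2) ℂ)) (μ : ℂ) :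
    U * (μ • 1 + M) * star U - μ • 1 = U * M * star U := by
  rw [mul_add, add_mul, mul_smul_comm, mul_one, smul_mul_assoc, (Unitary.mem_iff.1 hU).2,
    add_sub_cancel_left]

theorem spectrum_unitary_antidiagonal {U : Matrix (Fin 2) (Fin 2) ℂ}
    (hU : U ∈ unitary (Matrix (Fin 2) (Fin 2) ℂ)) (μ d : ℂ) (r s : ℝ) :
    spectrum ℂ (U * (μ • 1 + d • antidiagonal r s) * star U) =
      {z | (z - μ) ^ 2 = d ^ 2 * (r * s : ℝ)} := by
  ext z
  have hUdet : U.det * (star U).det = 1 := by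
    rw [← det_mul, (Unitary.mem_iff.1 hU).2, det_one]
  have h1 : algebraMap ℂ (Matrix (Fin 2) (Fin 2) ℂ) z -
      U * (μ • 1 + d • antidiagonal r s) * star U =
      U * ((z - μ) • 1 - d • antidiagonal r s) * star U := by
    simp only [Algebra.algebraMap_eq_smul_one, mul_sub, sub_mul, mul_add, add_mul, mul_smul_comm,
      mul_one, smul_mul_assoc, (Unitary.mem_iff.1 hU).2]
    module
  rw [spectrum.mem_iff, h1, isUnit_iff_isUnit_det, det_mul, det_mul, mul_right_comm, hUdet,
    one_mul, isUnit_iff_ne_zero, not_not, Set.mem_ofPred_eq, det_fin_two, ← sub_eq_zero (a := _ ^ 2)]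
  simp [antidiagonal]
  ring_nf

/-- The possible eigenvalues `μ ± d` are distinct, so no derivative is interpolated, and oddness
gives the values `±σ` there, which a linear polynomial attains. -/
theorem matrixFunction_odd_of_sq {A : Matrix (Fin 2) (Fin 2) ℂ} {μ d σ : ℂ} (hd : d ≠ 0)
    (hA : (A - μ • 1) * (A - μ • 1) = d ^ 2 • 1) {g : ℂ → ℂ} (hg : ∀ z, g (-z) = -g z)
    (hσ : g 1 = σ) :
    matrixFunction (fun z => g ((z - μ) / d)) A = (σ / d) • (A - μ • 1) := by
  have haeval (c : ℂ) : aeval A (X - C c) = A - c • 1 := by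
    simp [Algebra.algebraMap_eq_smul_one]
  have hp : InterpolatesOnSpectrum (fun z => g ((z - μ) / d)) A (C (σ / d) * (X - C μ)) := by
    intro z k hk
    have hdvd : minpoly ℂ A ∣ (X - C (μ + d)) * (X - C (μ - d)) := by
      refine minpoly.dvd ℂ A ?_
      have h2 : (X - C (μ + d)) * (X - C (μ - d)) = (X - C μ) * (X - C μ) - C (d ^ 2) := by
        simp only [C_add, C_sub, C_pow]
        ring
      rw [h2, map_sub, map_mul, haeval, hA, aeval_C, Algebra.algebraMap_eq_smul_one, sub_self]
    have hne : (X - C (μ + d)) * (X - C (μ - d)) ≠ 0 :=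
      mul_ne_zero (X_sub_C_ne_zero _) (X_sub_C_ne_zero _)
    have hle := hk.trans_le (rootMultiplicity_le_rootMultiplicity_of_dvd hne hdvd z)
    rw [rootMultiplicity_mul hne, rootMultiplicity_X_sub_C, rootMultiplicity_X_sub_C] at hle
    have hpm : μ + d ≠ μ - d := fun h => hd (by linear_combination h / 2)
    by_cases h1 : z = μ + d
    · rw [if_pos h1, if_neg (by rwa [h1])] at hle
      obtain rfl : k = 0 := by omega
      simp [h1, hd, hσ]
    · by_cases h2 : z = μ - d
      · rw [if_neg h1, if_pos h2] at hle
        obtain rfl : k = 0 := by omega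
        simp [h2, hd, hσ, hg]
      · rw [if_neg h1, if_neg h2] at hle
        omega
  rw [matrixFunction_eq_aeval hp, map_mul, haeval, aeval_C, Algebra.algebraMap_eq_smul_one,
    smul_mul_assoc, one_mul]

theorem matrixFunction_affine (A : Matrix (Fin 2) (Fin 2) ℂ) (μ d : ℂ) :
    matrixFunction (fun z => (z - μ) / d) A = d⁻¹ • (A - μ • 1) := by
  have hp : InterpolatesOnSpectrum (fun z => (z - μ) / d) A (C d⁻¹ * (X - C μ)) := by
    intro z k _
    have hf : (fun z => (z - μ) / d) = fun z => (C d⁻¹ * (X - C μ)).eval z := by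
      funext z
      simp [div_eq_inv_mul]
    rw [hf]
    clear hf
    have (q : ℂ[X]) : iteratedDeriv k (fun z => q.eval z) = fun z => (derivative^[k] q).eval z := by
      induction k with
      | zero => simp
      | succ k ih =>
        rw [iteratedDeriv_succ, ih (by omega), Function.iterate_succ_apply']
        funext z
        exact Polynomial.deriv _
    rw [this]
  rw [matrixFunction_eq_aeval hp]
  simp [Algebra.algebraMap_eq_smul_one]

/-- Rescaling one coordinate by a factor `δ ≤ 2` makes a unitary conjugate of an antidiagonal
matrix a contraction. -/
theorem exists_similar_contraction {U : Matrix (Fin 2) (Fin 2) ℂ}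
    (hU : U ∈ unitary (Matrix (Fin 2) (Fin 2) ℂ)) {r s δ : ℝ} (hδ1 : 1 ≤ δ) (hδ2 : δ ≤ 2)
    (hr0 : 0 ≤ r) (hs0 : 0 ≤ s) (hr : r ≤ δ) (hs : s * δ ≤ 1) :
    ∃ S : Matrix (Fin 2) (Fin 2) ℂ, IsUnit S ∧ ‖S‖ * ‖S⁻¹‖ ≤ 2 ∧
      ‖S * (U * antidiagonal r s * star U) * S⁻¹‖ ≤ 1 := by
  have hδ0 : 0 < δ := by linarith
  have hδc : (δ : ℂ) ≠ 0 := by exact_mod_cast hδ0.ne'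
  obtain ⟨hUU, hUU'⟩ := Unitary.mem_iff.1 hU
  set D : Matrix (Fin 2) (Fin 2) ℂ := diagonal ![1, (δ : ℂ)] with hD
  set D' : Matrix (Fin 2) (Fin 2) ℂ := diagonal ![1, (δ : ℂ)⁻¹] with hD'
  have hDD : D * D' = 1 := by
    rw [hD, hD', diagonal_mul_diagonal, ← diagonal_one]
    congr 1
    ext i
    fin_cases i <;> simp [hδc]
  have hSS : D * star U * (U * D') = 1 := by
    calc _ = D * (star U * U) * D' := by simp only [mul_assoc]
      _ = 1 := by rw [hUU, mul_one, hDD]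
  have hinv : (D * star U)⁻¹ = U * D' := inv_eq_right_inv hSS
  have hDn : ‖D‖ ≤ 2 := by
    rw [hD, l2_opNorm_diagonal, pi_norm_le_iff_of_nonneg zero_le_two]
    intro i
    fin_cases i
    · simp
    · simpa [abs_of_pos hδ0] using hδ2
  have hDn' : ‖D'‖ ≤ 1 := by
    rw [hD', l2_opNorm_diagonal, pi_norm_le_iff_of_nonneg zero_le_one]
    intro i
    fin_cases i
    · simp
    · simpa [abs_of_pos hδ0] using inv_le_one_of_one_le₀ hδ1
  refine ⟨D * star U, IsUnit.of_mul_eq_one _ hSS, ?_, ?_⟩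
  · rw [hinv, CStarRing.norm_mul_mem_unitary _ (Unitary.star_mem hU),
      CStarRing.norm_mem_unitary_mul _ hU]
    calc ‖D‖ * ‖D'‖ ≤ 2 * 1 := by gcongr
      _ = 2 := mul_one 2
  · have hP : antidiagonal 1 1 ∈ unitary (Matrix (Fin 2) (Fin 2) ℂ) := by
      have h1 : star (antidiagonal 1 1) = antidiagonal 1 1 := by
        ext i j
        fin_cases i <;> fin_cases j <;> simp [antidiagonal]
      rw [Unitary.mem_iff, h1, antidiagonal_mul_self]
      simp
    -- The rescaling divides the upper entry by `δ` and multiplies the lower one by `δ`; after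
    -- splitting off a unitary swap, the norm is the larger entry.
    have heq : D * star U * (U * antidiagonal r s * star U) * (U * D') =
        diagonal ![((r / δ : ℝ) : ℂ), ((s * δ : ℝ) : ℂ)] * antidiagonal 1 1 := by
      calc _ = D * (star U * U) * antidiagonal r s * (star U * U) * D' := by
            simp only [mul_assoc]
        _ = D * antidiagonal r s * D' := by rw [hUU, mul_one, mul_one]
        _ = _ := by
          ext i j
          fin_cases i <;> fin_cases j <;>
            simp [hD, hD', antidiagonal, div_eq_mul_inv, mul_comm]
    rw [hinv, heq, CStarRing.norm_mul_mem_unitary _ hP, l2_opNorm_diagonal,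
      pi_norm_le_iff_of_nonneg zero_le_one]
    intro i
    fin_cases i
    · simpa [abs_of_pos hδ0, abs_of_nonneg hr0] using (div_le_one hδ0).2 hr
    · simpa [abs_of_pos hδ0, abs_of_nonneg hs0] using hs

end MatrixFunction

/-! ### The theorem. -/

theorem mainTheorem5 (A : Matrix (Fin 2) (Fin 2) ℂ) (hA : ¬ IsStarNormal A) :
    (∃ (c₁ c₂ : ℂ) (ℓ : ℝ), spectrum ℂ A = {c₁, c₂} ∧ dist c₁ c₂ < ℓ ∧
      numericalRange A = ellipticalDisk c₁ c₂ ℓ) ∧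
    ∃ (a : ℂ → ℂ) (S : Matrix (Fin 2) (Fin 2) ℂ),
      IsConformalMapOnto a (interior (numericalRange A)) (Metric.ball 0 1) ∧
      IsUnit S ∧ ‖S‖ * ‖S⁻¹‖ ≤ 2 ∧ ‖S * matrixFunction a A * S⁻¹‖ ≤ 1 := by
  obtain ⟨U, hU, μ, d, hd, r, s, hAU, hcase⟩ := exists_unitary_antidiagonal hA
  have hspec := spectrum_unitary_antidiagonal hU μ d r s
  have hrange : numericalRange A =
      (fun z => μ + d * z) '' numericalRange (antidiagonal r s) := by
    rw [hAU, numericalRange_unitary_conj hU, numericalRange_add_smul]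
  have hsub : A - μ • 1 = d • (U * antidiagonal r s * star U) := by
    rw [hAU, sub_smul_one_eq_unitary_conj hU, mul_smul_comm, smul_mul_assoc]
  have hdn := norm_pos_iff.2 hd
  rw [← hAU] at hspec
  rcases hcase with ⟨τ, hτ, rfl, rfl⟩ | ⟨rfl, rfl⟩
  · have hmul : Real.exp τ * Real.exp (-τ) = 1 := by
      rw [← Real.exp_add, add_neg_cancel, Real.exp_zero]
    rw [numericalRange_antidiagonal_exp hτ] at hrange
    refine ⟨⟨μ + d * 1, μ + d * -1, ‖d‖ * (2 * Real.cosh τ), ?_, ?_, ?_⟩, ?_⟩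
    · rw [hspec, hmul]
      ext z
      rw [Set.mem_ofPred_eq, Set.mem_insert_iff, Set.mem_singleton_iff, Complex.ofReal_one, mul_one,
        sq_eq_sq_iff_eq_or_eq_neg, sub_eq_iff_eq_add, sub_eq_iff_eq_add, mul_one, mul_neg_one,
        add_comm d, add_comm (-d)]
    · rw [dist_add_left, dist_eq_norm, ← mul_sub, norm_mul]
      have := Real.one_lt_cosh.2 hτ.ne'
      norm_num
      nlinarith
    · rw [hrange, image_ellipticalDisk hd]
    · obtain ⟨σ, hσ, hσ0, hσ1, hσ2⟩ := ellipseMap_one hτ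
      have hfun : matrixFunction (fun z => ellipseMap τ ((z - μ) / d)) A =
          U * antidiagonal (σ * Real.exp τ) (σ * Real.exp (-τ)) * star U := by
        have hsq : (A - μ • 1) * (A - μ • 1) = d ^ 2 • 1 := by
          have hUU := (Unitary.mem_iff.1 hU).1
          rw [hsub, smul_mul_smul_comm, ← sq]
          congr 1
          calc _ = U * antidiagonal (Real.exp τ) (Real.exp (-τ)) * (star U * U) *
                antidiagonal (Real.exp τ) (Real.exp (-τ)) * star U := by simp only [mul_assoc]
            _ = 1 := by
              rw [hUU, mul_one, mul_assoc U, antidiagonal_mul_self, hmul, Complex.ofReal_one,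
                one_smul, mul_one, (Unitary.mem_iff.1 hU).2]
        rw [matrixFunction_odd_of_sq hd hsq (ellipseMap_neg τ) hσ, hsub, smul_smul,
          div_mul_cancel₀ _ hd, ← smul_mul_assoc, ← mul_smul_comm]
        congr 2
        ext i j
        fin_cases i <;> fin_cases j <;> simp [antidiagonal]
      have hexp := Real.exp_pos τ
      have hexp' : Real.exp (-τ) ≤ 1 := Real.exp_le_one_iff.2 (by linarith)
      -- The bound `σ ≤ 2e^{-τ}` gives `δ ≤ 2`. The rescaled lower entry is `max(σe^{-τ}, σ²)`, at
      -- most 1 because `σ ≤ 1`.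
      obtain ⟨S, hS⟩ := exists_similar_contraction hU
        (r := σ * Real.exp τ) (s := σ * Real.exp (-τ)) (δ := max 1 (σ * Real.exp τ))
        (le_max_left _ _) (max_le one_le_two (by nlinarith)) (by positivity) (by positivity)
        (le_max_right _ _) (by
          rw [mul_max_of_nonneg _ _ (by positivity)]
          refine max_le (by nlinarith) ?_
          rw [show σ * Real.exp (-τ) * (σ * Real.exp τ) =
            σ * σ * (Real.exp τ * Real.exp (-τ)) by ring, hmul]
          nlinarith)
      refine ⟨fun z => ellipseMap τ ((z - μ) / d), S, ?_, ?_⟩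
      · rw [hrange, interior_image_affine hd]
        exact (isConformalMapOnto_ellipseMap hτ).comp_affine hd
      · rwa [hfun]
  · rw [numericalRange_antidiagonal_two_zero] at hrange
    refine ⟨⟨μ + d * 0, μ + d * 0, ‖d‖ * 2, ?_, ?_, ?_⟩, ?_⟩
    · rw [hspec]
      ext z
      simp [sub_eq_zero]
    · rw [dist_self]
      positivity
    · rw [hrange, image_ellipticalDisk hd]
    -- For the disk the map is affine and `a(A)` has entries `2, 0`, so the full factor `2` is used.
    · obtain ⟨S, hS⟩ := exists_similar_contraction hU (r := 2) (s := 0) (δ := 2)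
        one_le_two le_rfl zero_le_two le_rfl le_rfl (by norm_num)
      refine ⟨fun z => (z - μ) / d, S, ?_, ?_⟩
      · rw [hrange, interior_image_affine hd]
        have hball : ellipticalDisk 0 0 2 = Metric.closedBall 0 1 := by
          ext z
          simp only [ellipticalDisk, Set.mem_ofPred_eq, dist_zero_right, mem_closedBall_zero_iff]
          constructor <;> intro h <;> linarith
        rw [hball, interior_closedBall _ one_ne_zero]
        exact IsConformalMapOnto.comp_affine (g := id)
          ⟨differentiableOn_id, Set.bijOn_id _⟩ hd
      · rwa [matrixFunction_affine, hsub, smul_smul, inv_mul_cancel₀ hd, one_smul]
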